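/- Let $k\ge 2$ be an integer, let $\Gamma=F(A_1,\dots,A_k)$ be the free group on $k$ generators, and put $q=2k-1$ and $\sigma^2=\frac1{k-1}$, $\sigma>0$. For $1\le j\le k$ let $\log_j:\Gamma\to\mathbb Z$ be the homomorphism with $\log_j(A_i)=\delta_{ij}$, and let $\Phi(\gamma)=(\log_1\gamma,\dots,\log_k\gamma)\in\mathbb Z^k$. A reduced word is cyclically reduced if the product of its first and last letters is not the identity (the empty word is counted as cyclically reduced). For $\beta\in\mathbb Z^k$ and an integer $m\ge 0$ let $N_\beta(m)$ be the number of $\gamma\in\Gamma$ whose reduced word is cyclically reduced and has length at most $m$ and for which $\Phi(\gamma)=\beta$. Write $|\beta|^2=\beta_1^2+\dots+\beta_k^2$. Then for every subset $B\subseteq\mathbb Z^k$, as $m\to\infty$ through the positive integers, $$\sum_{\substack{\beta\in B\\ |\beta_i|\le\sqrt m\,\log m\ (1\le i\le k)}}\left(m^{k/2}\cdot\frac12\left(\frac{N_\beta(m)}{q^{m+1}/(q-1)}+\frac{N_\beta(m+1)}{q^{m+2}/(q-1)}\right)-\frac{1}{(2\pi\sigma^2)^{k/2}}\,e^{-|\beta|^2/(2\sigma^2m)}\right)=o\bigl(m^{k/2}\bigr).$$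 -/

import Mathlib

open scoped Asymptotics BigOperators

namespace FreeGroupLog

/-- The discrete logarithm `log_j : F(A_1, …, A_k) → ℤ`: the homomorphism to the additive group `ℤ`
with `A_i ↦ δ_{ij}`. -/
def discreteLogHom (k : ℕ) (j : Fin k) : FreeGroup (Fin k) →* Multiplicative ℤ :=
  FreeGroup.lift fun i => Multiplicative.ofAdd (if i = j then 1 else 0)

/-- The vector `Φ(γ) = (log_1 γ, …, log_k γ)` of discrete logarithms. -/
def discreteLog {k : ℕ} (γ : FreeGroup (Fin k)) : Fin k → ℤ :=
  fun j => (discreteLogHom k j γ).toAdd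

/-- The elements of the free group whose reduced word is cyclically reduced, has word length at most
`m`, and has discrete-logarithm vector `β`. -/
def cyclicallyReducedSet {k : ℕ} (β : Fin k → ℤ) (m : ℕ) : Set (FreeGroup (Fin k)) :=
  {γ | FreeGroup.IsCyclicallyReduced γ.toWord ∧ γ.norm ≤ m ∧ discreteLog γ = β}

theorem cyclicallyReducedSet_finite {k : ℕ} (β : Fin k → ℤ) (m : ℕ) :
    (cyclicallyReducedSet β m).Finite := by
  refine Set.Finite.subset
    ((List.finite_length_le (Fin k × Bool) m).preimage FreeGroup.toWord_injective.injOn) ?_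
  intro γ hγ
  exact hγ.2.1

/-- The counting function `N_β(m)`. -/
noncomputable def cyclicallyReducedCount {k : ℕ} (β : Fin k → ℤ) (m : ℕ) : ℕ :=
  (cyclicallyReducedSet β m).ncard

/-- The points `β ∈ B` with `|β_i| ≤ √m log m` for every `i`. -/
def window {k : ℕ} (B : Set (Fin k → ℤ)) (m : ℕ) : Set (Fin k → ℤ) :=
  {β | β ∈ B ∧ ∀ i, |(β i : ℝ)| ≤ Real.sqrt (m : ℝ) * Real.log (m : ℝ)}

theorem window_finite {k : ℕ} (B : Set (Fin k → ℤ)) (m : ℕ) : (window B m).Finite := by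
  refine (Set.Finite.pi' fun _ : Fin k =>
    Set.finite_Icc (-⌊Real.sqrt (m : ℝ) * Real.log (m : ℝ)⌋)
      ⌊Real.sqrt (m : ℝ) * Real.log (m : ℝ)⌋).subset ?_
  intro β hβ i
  have h := abs_le.1 (hβ.2 i)
  refine ⟨?_, Int.le_floor.2 h.2⟩
  rw [neg_le]
  refine Int.le_floor.2 ?_
  push_cast
  linarith [h.1]

end FreeGroupLog

/-! A cyclically reduced word is a closed non-backtracking walk on the `2k` letters. Weighting each
letter by a character of `ℤ ^ k` therefore turns the character sum over cyclically reduced words of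
length `n` into the trace of the `n`-th power of a transfer matrix. That matrix is a rank-one matrix
minus an involution, so the trace is explicit (`trace_transferMatrix_pow`): besides `±1`, only the
roots of `X ^ 2 - S X + q` contribute, where `S = ∑ 2 cos θ_i`. At `θ = φ / √m` the larger root is
`q (1 - |φ|² / ((q - 1) m) + o(1/m))`, so the normalized sum tends to `exp (-|φ|² / (2 (k - 1)))`,
the characteristic function of a Gaussian of variance `1 / (k - 1)`.

Word length and `∑ β_i` have the same parity, so each sphere charges one coset of the even
sublattice, and Fourier inversion takes place on a torus of half the volume. This removes the second
peak at `θ = (π, …, π)`. Averaging the normalized counts at `m` and `m + 1` gives both parities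
asymptotic mass `1/2`, so a single Gaussian serves every `β`. Dominated convergence yields a local
limit theorem with error uniform in `β` (`abs_averagedCount_sub_scaledGaussian_le`).

A uniform error alone does not suffice, since the window has about `m^(k/2) (2 log m)^k` points. A
Scheffé argument closes the gap: the averaged counts and the discretized Gaussian both have total
mass tending to `1`, and local convergence on boxes of side `R √m` together with a Gaussian tail
bound controls the deficit. This gives convergence in total variation
(`eventually_abs_sum_averagedCount_sub_gaussian_le`), hence the claim on any finite set. -/

namespace FreeGroupLog

/-! ### Words of fixed length -/

section Words

/-- The words of length `n` over a finite alphabet. -/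
def wordsOfLength (α : Type*) [Fintype α] [DecidableEq α] : ℕ → Finset (List α)
  | 0 => {[]}
  | n + 1 => (Finset.univ ×ˢ wordsOfLength α n).image fun p => p.1 :: p.2

variable {α : Type*} [Fintype α] [DecidableEq α]

theorem mem_wordsOfLength {n : ℕ} {w : List α} : w ∈ wordsOfLength α n ↔ w.length = n := by
  induction n generalizing w with
  | zero => simp [wordsOfLength]
  | succ n ih => cases w <;> simp [wordsOfLength, ih]

theorem sum_wordsOfLength_succ {R : Type*} [AddCommMonoid R] (n : ℕ) (f : List α → R) :
    ∑ w ∈ wordsOfLength α (n + 1), f w = ∑ a, ∑ w ∈ wordsOfLength α n, f (a :: w) := by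
  rw [wordsOfLength, Finset.sum_image, Finset.sum_product]
  rintro ⟨a, w⟩ _ ⟨b, v⟩ _ h
  simpa using h

end Words

/-! ### Transfer matrix and Ihara's trace formula -/

section TransferMatrix

variable {k : ℕ} {R : Type*} [CommRing R]

/-- The weighted non-backtracking transfer matrix of the alphabet `A_i^{±1}`. -/
def transferMatrix (z : Fin k × Bool → R) : Matrix (Fin k × Bool) (Fin k × Bool) R :=
  Matrix.of fun a b => if a.1 = b.1 → a.2 = b.2 then z a else 0

open scoped Classical in
theorem transferMatrix_pow_succ_apply (z : Fin k × Bool → R) (n : ℕ) (a b : Fin k × Bool) :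
    (transferMatrix z ^ (n + 1)) a b = ∑ w ∈ wordsOfLength (Fin k × Bool) n,
      if FreeGroup.IsReduced (a :: w ++ [b]) then ((a :: w).map z).prod else 0 := by
  induction n generalizing a with
  | zero => simp [wordsOfLength, transferMatrix, FreeGroup.IsReduced]
  | succ n ih =>
    rw [pow_succ', Matrix.mul_apply, sum_wordsOfLength_succ]
    refine Finset.sum_congr rfl fun c _ => ?_
    rw [ih, Finset.mul_sum]
    refine Finset.sum_congr rfl fun w _ => ?_
    have : FreeGroup.IsReduced (a :: (c :: w) ++ [b]) ↔
        (a.1 = c.1 → a.2 = c.2) ∧ FreeGroup.IsReduced (c :: w ++ [b]) := by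
      simp [FreeGroup.IsReduced]
    rw [this]
    simp only [transferMatrix, Matrix.of_apply]
    split_ifs <;> simp_all

/-- Repeating the first letter at the end adds exactly one adjacent pair, last letter then first,
which is the cyclic condition. Diagonal entries of matrix powers thus see cyclically reduced words.
-/
theorem isReduced_cons_append_head_iff (a : Fin k × Bool) (w : List (Fin k × Bool)) :
    FreeGroup.IsReduced (a :: w ++ [a]) ↔ FreeGroup.IsCyclicallyReduced (a :: w) := by
  rw [FreeGroup.IsReduced, List.isChain_append, FreeGroup.isCyclicallyReduced_iff]
  simp [FreeGroup.IsReduced]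

open scoped Classical in
theorem trace_transferMatrix_pow_succ (z : Fin k × Bool → R) (n : ℕ) :
    (transferMatrix z ^ (n + 1)).trace =
      ∑ w ∈ (wordsOfLength (Fin k × Bool) (n + 1)).filter FreeGroup.IsCyclicallyReduced,
        (w.map z).prod := by
  rw [Finset.sum_filter, sum_wordsOfLength_succ, Matrix.trace]
  refine Finset.sum_congr rfl fun a _ => ?_
  rw [Matrix.diag_apply, transferMatrix_pow_succ_apply]
  simp only [isReduced_cons_append_head_iff]

/-- The power sums `λ₁ ^ n + λ₂ ^ n` of the roots of `X ^ 2 - s X + q`. -/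
def powerSum (q s : R) : ℕ → R
  | 0 => 2
  | 1 => s
  | n + 2 => s * powerSum q s (n + 1) - q * powerSum q s n

theorem powerSum_ofReal (q s : ℝ) (m : ℕ) :
    ((powerSum q s m : ℝ) : ℂ) = powerSum (q : ℂ) (s : ℂ) m := by
  have : ((powerSum q s m : ℝ) : ℂ) = powerSum (q : ℂ) (s : ℂ) m ∧
      ((powerSum q s (m + 1) : ℝ) : ℂ) = powerSum (q : ℂ) (s : ℂ) (m + 1) := by
    induction m with
    | zero => simp [powerSum]
    | succ m ih => exact ⟨ih.2, by simp [powerSum, ih.1, ih.2]⟩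
  exact this.1

open Matrix in
/-- Ihara's determinant formula for the bouquet of `k` circles, in terms of power traces. -/
theorem trace_transferMatrix_pow (z : Fin k × Bool → R)
    (hz : ∀ i, z (i, true) * z (i, false) = 1) (n : ℕ) :
    (transferMatrix z ^ n).trace =
      powerSum (2 * (k : R) - 1) (∑ a, z a) n + ((k : R) - 1) * (1 + (-1) ^ n) := by
  set S := ∑ a, z a with hS
  set q : R := 2 * k - 1 with hq
  have hz' : ∀ i b, z (i, b) * z (i, !b) = 1 := by
    intro i b
    cases b
    · rw [mul_comm]; exact hz i
    · exact hz i
  set M := transferMatrix z with hM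
  let e : Fin k × Bool → Fin k × Bool := fun a => (a.1, !a.2)
  have hee : ∀ a, e (e a) = a := fun a => by simp [e]
  -- `K` is the weighted backtracking step. Adding it to `M` removes the non-backtracking constraint
  -- and leaves rank one; `K * K = 1` because inverse letters have inverse weights. The span of `z`
  -- and `1` is then stable under `M`.
  let K : Matrix (Fin k × Bool) (Fin k × Bool) R := of fun a b => if b = e a then z a else 0
  have hMK : M + K = vecMulVec z 1 := by
    ext ⟨i, b⟩ ⟨j, c⟩
    simp only [hM, transferMatrix, K, e, Matrix.add_apply, of_apply, vecMulVec_apply, Pi.one_apply,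
      mul_one, Prod.mk.injEq]
    by_cases hij : i = j
    · subst hij
      cases b <;> cases c <;> simp
    · simp [hij, Ne.symm hij]
  have hKK : K * K = 1 := by
    ext a b
    simp only [K, mul_apply, of_apply, ite_mul, zero_mul, Finset.sum_ite_eq', Finset.mem_univ,
      if_true, hee]
    rw [Matrix.one_apply]
    by_cases h : a = b
    · subst h
      simpa using hz' a.1 a.2
    · simp [h, Ne.symm h]
  have hKz : K *ᵥ z = 1 := by
    ext a
    simp only [K, mulVec, dotProduct, of_apply, ite_mul, zero_mul, Finset.sum_ite_eq',
      Finset.mem_univ, if_true, Pi.one_apply]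
    exact hz' a.1 a.2
  have hK1 : K *ᵥ 1 = z := by
    ext a
    simp [K, mulVec, dotProduct]
  have hM' : M = vecMulVec z 1 - K := by rw [← hMK]; simp
  have hMz : M *ᵥ z = S • z - 1 := by
    rw [hM', sub_mulVec, hKz, vecMulVec_mulVec]
    ext a
    simp [dotProduct, hS, mul_comm]
  have hM1 : M *ᵥ 1 = q • z := by
    rw [hM', sub_mulVec, hK1, vecMulVec_mulVec]
    ext a
    simp [dotProduct, hq, mul_comm]
    ring
  let u : ℕ → R := fun n => 1 ⬝ᵥ ((M ^ n) *ᵥ 1)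
  let v : ℕ → R := fun n => 1 ⬝ᵥ ((M ^ n) *ᵥ z)
  have hu : ∀ n, u (n + 1) = q * v n := by
    intro n
    simp only [u, v, pow_succ, ← mulVec_mulVec, hM1, mulVec_smul, dotProduct_smul, smul_eq_mul]
  have hv : ∀ n, v (n + 1) = S * v n - u n := by
    intro n
    simp only [u, v, pow_succ, ← mulVec_mulVec, hMz, mulVec_smul, mulVec_sub, dotProduct_smul,
      dotProduct_sub, smul_eq_mul]
  have hu0 : u 0 = 2 * k := by simp [u, mul_comm]
  have hv0 : v 0 = S := by simp [v, hS, dotProduct]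
  -- Split one factor as `M = z 1ᵀ - K`, then use `K M = 1 1ᵀ - I`: traces two steps apart differ
  -- only by quantities living on the span of `z` and `1`.
  have ht : ∀ n, (M ^ (n + 2)).trace = (M ^ n).trace + v (n + 1) - u n := by
    intro n
    have h1 : (M ^ (n + 2)).trace + (K * M ^ (n + 1)).trace = v (n + 1) := by
      rw [pow_succ' M (n + 1), ← trace_add, ← add_mul, hMK, vecMulVec_mul, trace_vecMulVec]
      simp only [v]
      rw [dotProduct_mulVec, dotProduct_comm]
    have h2 : (K * M ^ (n + 1)).trace = u n - (M ^ n).trace := by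
      have : K * M = vecMulVec 1 1 - 1 := by
        rw [hM', mul_sub, hKK, mul_vecMulVec, hKz]
      rw [pow_succ' M n, ← mul_assoc, this, sub_mul, one_mul, trace_sub, vecMulVec_mul,
        trace_vecMulVec]
      simp only [u]
      rw [dotProduct_mulVec, dotProduct_comm]
    rw [h2] at h1
    linear_combination h1
  -- Both sides satisfy the recursion of `X ^ 2 - S X + q`, so two initial values decide. Hence the
  -- trace minus the power sum is 2-periodic, which accounts for the eigenvalues `±1`.
  have hL : ∀ n, v (n + 1) - u n = powerSum q S (n + 2) - powerSum q S n ∧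
      v (n + 2) - u (n + 1) = powerSum q S (n + 3) - powerSum q S (n + 1) := by
    intro n
    induction n with
    | zero =>
      constructor
      · simp only [hv, hu0, hv0, powerSum]; ring
      · simp only [hv, hu, hu0, hv0, powerSum]; rw [hq]; ring
    | succ n ih =>
      refine ⟨ih.2, ?_⟩
      have e1 := ih.1
      have e2 := ih.2
      have p4 : powerSum q S (n + 4) = S * powerSum q S (n + 3) - q * powerSum q S (n + 2) := rfl
      have p2 : powerSum q S (n + 2) = S * powerSum q S (n + 1) - q * powerSum q S n := rfl
      change v (n + 3) - u (n + 2) = powerSum q S (n + 4) - powerSum q S (n + 2)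
      rw [p4, hv (n + 2), hu (n + 1)]
      linear_combination S * e2 - q * e1 + p2 + S * hu n - q * hv n
  have key : ∀ n, (M ^ n).trace = powerSum q S n + ((k : R) - 1) * (1 + (-1) ^ n) ∧
      (M ^ (n + 1)).trace = powerSum q S (n + 1) + ((k : R) - 1) * (1 + (-1) ^ (n + 1)) := by
    intro n
    induction n with
    | zero =>
      constructor
      · simp [powerSum]; ring
      · simp [powerSum, hM, transferMatrix, Matrix.trace, hS]
    | succ n ih =>
      refine ⟨ih.2, ?_⟩
      rw [ht n, ih.1]
      have := (hL n).1
      linear_combination this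
  exact (key n).1

end TransferMatrix

/-! ### Logarithm vectors, parity and character sums -/

section CharacterSum

variable {k : ℕ}

theorem discreteLog_mul (x y : FreeGroup (Fin k)) :
    discreteLog (x * y) = discreteLog x + discreteLog y := by
  ext j
  simp [discreteLog]

theorem discreteLog_one : discreteLog (1 : FreeGroup (Fin k)) = 0 := by
  ext j
  simp [discreteLog]

theorem discreteLog_mk_singleton (i : Fin k) (b : Bool) :
    discreteLog (FreeGroup.mk [(i, b)]) = if b then Pi.single i 1 else -Pi.single i 1 := by
  ext j
  rcases eq_or_ne i j with rfl | h
  · cases b <;> simp [discreteLog, discreteLogHom, FreeGroup.lift_mk]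
  · cases b <;> simp [discreteLog, discreteLogHom, FreeGroup.lift_mk, h, h.symm]

theorem discreteLog_mk_cons (a : Fin k × Bool) (w : List (Fin k × Bool)) :
    discreteLog (FreeGroup.mk (a :: w)) =
      (if a.2 then Pi.single a.1 1 else -Pi.single a.1 1) + discreteLog (FreeGroup.mk w) := by
  rw [← discreteLog_mk_singleton, ← discreteLog_mul, FreeGroup.mul_mk]
  rfl

theorem sum_discreteLog_mk_emod_two (w : List (Fin k × Bool)) :
    (∑ i, discreteLog (FreeGroup.mk w) i) % 2 = (w.length : ℤ) % 2 := by
  induction w with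
  | nil => simp [← FreeGroup.one_eq_mk, discreteLog_one]
  | cons a w ih =>
    rw [discreteLog_mk_cons]
    simp only [Pi.add_apply, Finset.sum_add_distrib, List.length_cons]
    rcases a with ⟨i, b⟩
    cases b <;> simp <;> omega

/-- The total displacement has the parity of the word length. -/
theorem sum_discreteLog_emod_two (γ : FreeGroup (Fin k)) :
    (∑ i, discreteLog γ i) % 2 = (γ.norm : ℤ) % 2 := by
  have := sum_discreteLog_mk_emod_two γ.toWord
  rwa [FreeGroup.mk_toWord] at this

open scoped Classical in
/-- The elements of length `n` with cyclically reduced reduced word. -/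
noncomputable def cyclicallyReducedOfNorm (k n : ℕ) : Finset (FreeGroup (Fin k)) :=
  ((wordsOfLength (Fin k × Bool) n).filter FreeGroup.IsCyclicallyReduced).image FreeGroup.mk

theorem mem_cyclicallyReducedOfNorm {n : ℕ} {γ : FreeGroup (Fin k)} :
    γ ∈ cyclicallyReducedOfNorm k n ↔
      FreeGroup.IsCyclicallyReduced γ.toWord ∧ γ.norm = n := by
  simp only [cyclicallyReducedOfNorm, Finset.mem_image, Finset.mem_filter, mem_wordsOfLength]
  constructor
  · rintro ⟨w, ⟨hn, hw⟩, rfl⟩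
    rw [FreeGroup.norm, FreeGroup.toWord_mk, hw.isReduced.reduce_eq]
    exact ⟨hw, hn⟩
  · rintro ⟨h, hn⟩
    exact ⟨γ.toWord, ⟨hn, h⟩, FreeGroup.mk_toWord⟩

open scoped Classical in
theorem sum_cyclicallyReducedOfNorm {R : Type*} [AddCommMonoid R] (n : ℕ)
    (f : FreeGroup (Fin k) → R) :
    ∑ γ ∈ cyclicallyReducedOfNorm k n, f γ =
      ∑ w ∈ (wordsOfLength (Fin k × Bool) n).filter FreeGroup.IsCyclicallyReduced,
        f (FreeGroup.mk w) := by
  rw [cyclicallyReducedOfNorm, Finset.sum_image]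
  intro w hw v hv h
  have hw' := (Finset.mem_filter.1 hw).2.isReduced.reduce_eq
  have hv' := (Finset.mem_filter.1 hv).2.isReduced.reduce_eq
  rw [← hw', ← hv', ← FreeGroup.toWord_mk, ← FreeGroup.toWord_mk, h]

/-- The character `β ↦ exp (i ⟨θ, β⟩)` of `ℤ ^ k`. -/
noncomputable def latticeChar (θ : Fin k → ℝ) (β : Fin k → ℤ) : ℂ :=
  Complex.exp (Complex.I * ∑ i, (θ i : ℂ) * (β i : ℂ))

theorem latticeChar_add (θ : Fin k → ℝ) (β δ : Fin k → ℤ) :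
    latticeChar θ (β + δ) = latticeChar θ β * latticeChar θ δ := by
  simp [latticeChar, ← Complex.exp_add, mul_add, Finset.sum_add_distrib]

theorem latticeChar_zero (θ : Fin k → ℝ) : latticeChar θ 0 = 1 := by
  simp [latticeChar]

theorem norm_latticeChar (θ : Fin k → ℝ) (β : Fin k → ℤ) : ‖latticeChar θ β‖ = 1 := by
  have : Complex.I * ∑ i, (θ i : ℂ) * (β i : ℂ) = ((∑ i, θ i * β i : ℝ) : ℂ) * Complex.I := by
    push_cast; ring
  rw [latticeChar, this, Complex.norm_exp_ofReal_mul_I]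

@[fun_prop]
theorem continuous_latticeChar (β : Fin k → ℤ) :
    Continuous fun θ : Fin k → ℝ => latticeChar θ β := by
  unfold latticeChar
  fun_prop

/-- The character sum over cyclically reduced elements of length `n`. -/
noncomputable def characterSum (k n : ℕ) (θ : Fin k → ℝ) : ℂ :=
  ∑ γ ∈ cyclicallyReducedOfNorm k n, latticeChar θ (discreteLog γ)

theorem continuous_characterSum (k n : ℕ) : Continuous (characterSum k n) := by
  unfold characterSum
  fun_prop

theorem characterSum_zero_left (θ : Fin k → ℝ) : characterSum k 0 θ = 1 := by
  have : cyclicallyReducedOfNorm k 0 = {1} := by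
    ext γ
    rw [mem_cyclicallyReducedOfNorm, FreeGroup.norm_eq_zero, Finset.mem_singleton]
    constructor
    · exact fun h => h.2
    · rintro rfl; simp
  simp [characterSum, this, discreteLog_one, latticeChar_zero]

theorem latticeChar_discreteLog_mk (θ : Fin k → ℝ) (w : List (Fin k × Bool)) :
    latticeChar θ (discreteLog (FreeGroup.mk w)) = (w.map fun a =>
      Complex.exp (Complex.I * if a.2 then (θ a.1 : ℂ) else -(θ a.1 : ℂ))).prod := by
  induction w with
  | nil => simp [← FreeGroup.one_eq_mk, discreteLog_one, latticeChar_zero]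
  | cons a w ih =>
    rw [discreteLog_mk_cons, latticeChar_add, ih, List.map_cons, List.prod_cons]
    congr 1
    rcases a with ⟨i, b⟩
    cases b <;> simp [latticeChar, Pi.single_apply]

theorem characterSum_eq (n : ℕ) (hn : n ≠ 0) (θ : Fin k → ℝ) :
    characterSum k n θ = ((powerSum (2 * (k : ℝ) - 1) (∑ i, 2 * Real.cos (θ i)) n
      + ((k : ℝ) - 1) * (1 + (-1) ^ n) : ℝ) : ℂ) := by
  classical
  obtain ⟨n, rfl⟩ := Nat.exists_eq_succ_of_ne_zero hn
  rw [characterSum, sum_cyclicallyReducedOfNorm]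
  simp only [latticeChar_discreteLog_mk]
  rw [← trace_transferMatrix_pow_succ (fun a : Fin k × Bool =>
      Complex.exp (Complex.I * if a.2 then (θ a.1 : ℂ) else -(θ a.1 : ℂ))),
    trace_transferMatrix_pow]
  · push_cast
    rw [powerSum_ofReal]
    push_cast
    congr 2
    rw [Fintype.sum_prod_type]
    refine Finset.sum_congr rfl fun i _ => ?_
    rw [Fintype.sum_bool, Complex.two_cos]
    simp [mul_comm]
  · intro i
    simp [← Complex.exp_add]

end CharacterSum

end FreeGroupLog

namespace FreeGroupLog

open Filter Topology

/-! ### Size and asymptotics of the power sums -/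

section PowerSum

theorem powerSum_eq_add_pow {R : Type*} [CommRing R] {q s a b : R} (hs : a + b = s)
    (hq : a * b = q) (n : ℕ) : powerSum q s n = a ^ n + b ^ n := by
  have : powerSum q s n = a ^ n + b ^ n ∧ powerSum q s (n + 1) = a ^ (n + 1) + b ^ (n + 1) := by
    induction n with
    | zero => exact ⟨by norm_num [powerSum], by simp [powerSum, hs]⟩
    | succ n ih =>
      refine ⟨ih.2, ?_⟩
      rw [powerSum, ih.1, ih.2, ← hs, ← hq]
      ring
  exact this.1

/-- Both roots of `X ^ 2 - s X + q` have modulus at most `r`. Non-real roots have modulus `√q ≤ r`.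
For real roots the bound on `|s|` says `r ^ 2 - |s| r + q ≥ 0`, and `r ≥ √q` places `r` beyond the
root of largest modulus. -/
theorem abs_powerSum_le {q s r : ℝ} (hr : 0 < r) (hq : 0 < q) (hqr : q ≤ r ^ 2)
    (hs : |s| ≤ r + q / r) (n : ℕ) : |powerSum q s n| ≤ 2 * r ^ n := by
  rcases lt_or_ge (s ^ 2) (4 * q) with h | h
  · set d := Real.sqrt (4 * q - s ^ 2) with hd
    have hd2 : d ^ 2 = 4 * q - s ^ 2 := Real.sq_sqrt (by linarith)
    set a : ℂ := ⟨s / 2, d / 2⟩ with ha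
    set b : ℂ := ⟨s / 2, -(d / 2)⟩ with hb
    have hna : ‖a‖ ≤ r := by
      rw [← abs_of_pos hr, ← abs_of_nonneg (norm_nonneg a), ← sq_le_sq, Complex.sq_norm,
        Complex.normSq_apply]
      simp only [ha]
      nlinarith
    have hnb : ‖b‖ ≤ r := by
      rw [← abs_of_pos hr, ← abs_of_nonneg (norm_nonneg b), ← sq_le_sq, Complex.sq_norm,
        Complex.normSq_apply]
      simp only [hb]
      nlinarith
    have hsum : a + b = (s : ℂ) := by
      apply Complex.ext <;> simp [ha, hb]
    have hprod : a * b = (q : ℂ) := by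
      apply Complex.ext
      · simp [ha, hb]; nlinarith
      · simp [ha, hb]; ring
    have := powerSum_eq_add_pow hsum hprod n
    rw [← powerSum_ofReal] at this
    rw [← Real.norm_eq_abs, ← Complex.norm_real, this]
    calc ‖a ^ n + b ^ n‖ ≤ ‖a‖ ^ n + ‖b‖ ^ n := by
          simpa only [norm_pow] using norm_add_le (a ^ n) (b ^ n)
      _ ≤ r ^ n + r ^ n := by gcongr
      _ = 2 * r ^ n := by ring
  · set d := Real.sqrt (s ^ 2 - 4 * q) with hd
    have hd0 : 0 ≤ d := Real.sqrt_nonneg _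
    have hd2 : d ^ 2 = s ^ 2 - 4 * q := Real.sq_sqrt (by linarith)
    have hsr : |s| * r ≤ r ^ 2 + q := by
      calc |s| * r ≤ (r + q / r) * r := by gcongr
        _ = r ^ 2 + q := by field_simp
    have hs2 : |s| ≤ 2 * r := by
      have : q / r ≤ r := by rw [div_le_iff₀ hr]; nlinarith
      linarith
    have hdr : d ≤ 2 * r - |s| := by
      refine abs_le_of_sq_le_sq' ?_ (by linarith) |>.2
      rw [hd2]
      nlinarith [sq_abs s]
    have hsplit := abs_le.1 (le_refl |s|)
    have ha : |(s + d) / 2| ≤ r := abs_le.2 ⟨by linarith, by linarith⟩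
    have hb : |(s - d) / 2| ≤ r := abs_le.2 ⟨by linarith, by linarith⟩
    rw [powerSum_eq_add_pow (a := (s + d) / 2) (b := (s - d) / 2) (by ring) (by nlinarith)]
    calc |((s + d) / 2) ^ n + ((s - d) / 2) ^ n| ≤ |(s + d) / 2| ^ n + |(s - d) / 2| ^ n := by
          simpa only [abs_pow] using abs_add_le (((s + d) / 2) ^ n) (((s - d) / 2) ^ n)
      _ ≤ r ^ n + r ^ n := by gcongr
      _ = 2 * r ^ n := by ring

/-- At `s = q + 1` the roots are `q` and `1`. The perturbed large root satisfies `m (a / q - 1) → -t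
/ (q - 1)`, which gives the exponential; the small root stays near `1 < q` and disappears, as does
the effect of the fixed shift `j`. -/
theorem tendsto_powerSum_div_pow {q t : ℝ} (hq : 1 < q) {s : ℕ → ℝ}
    (hs : Tendsto (fun m : ℕ => (m : ℝ) * (q + 1 - s m)) atTop (𝓝 t)) (j : ℕ) :
    Tendsto (fun m : ℕ => powerSum q (s m) (m + 1 - j) / q ^ (m + 1 - j)) atTop
      (𝓝 (Real.exp (-t / (q - 1)))) := by
  have hq0 : 0 < q := by linarith
  have hs1 : Tendsto s atTop (𝓝 (q + 1)) := by
    have h0 : Tendsto (fun m : ℕ => (m : ℝ)⁻¹ * ((m : ℝ) * (q + 1 - s m))) atTop (𝓝 (0 * t)) :=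
      tendsto_inv_atTop_nhds_zero_nat.mul hs
    have h1 : Tendsto (fun m : ℕ => q + 1 - (m : ℝ)⁻¹ * ((m : ℝ) * (q + 1 - s m))) atTop
        (𝓝 (q + 1 - 0 * t)) := tendsto_const_nhds.sub h0
    rw [zero_mul, sub_zero] at h1
    refine h1.congr' ?_
    filter_upwards [eventually_ge_atTop 1] with m hm
    have : (m : ℝ) ≠ 0 := by positivity
    field_simp
    ring
  set a : ℕ → ℝ := fun m => (s m + Real.sqrt ((s m) ^ 2 - 4 * q)) / 2 with ha
  set b : ℕ → ℝ := fun m => (s m - Real.sqrt ((s m) ^ 2 - 4 * q)) / 2 with hb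
  have hsq : Real.sqrt ((q + 1) ^ 2 - 4 * q) = q - 1 := by
    rw [show (q + 1) ^ 2 - 4 * q = (q - 1) ^ 2 by ring, Real.sqrt_sq (by linarith)]
  have hroot : Tendsto (fun m => Real.sqrt ((s m) ^ 2 - 4 * q)) atTop (𝓝 (q - 1)) := by
    rw [← hsq]
    exact ((hs1.pow 2).sub_const _).sqrt
  have haq : Tendsto a atTop (𝓝 q) := by
    have := (hs1.add hroot).div_const 2
    rwa [show (q + 1 + (q - 1)) / 2 = q by ring] at this
  have hbq : Tendsto b atTop (𝓝 1) := by
    have := (hs1.sub hroot).div_const 2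
    rwa [show (q + 1 - (q - 1)) / 2 = (1 : ℝ) by ring] at this
  have hdisc : ∀ᶠ m in atTop, 0 < (s m) ^ 2 - 4 * q := by
    have : Tendsto (fun m => (s m) ^ 2 - 4 * q) atTop (𝓝 ((q + 1) ^ 2 - 4 * q)) :=
      (hs1.pow 2).sub_const _
    refine this.eventually (lt_mem_nhds ?_)
    nlinarith [sq_pos_of_pos (sub_pos.2 hq)]
  have hab : ∀ m, a m + b m = s m := fun m => by simp only [ha, hb]; ring
  have habm : ∀ᶠ m in atTop, a m * b m = q := by
    filter_upwards [hdisc] with m hm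
    simp only [ha, hb]
    nlinarith [Real.sq_sqrt hm.le]
  have hsub : Tendsto (fun m : ℕ => m + 1 - j) atTop atTop :=
    tendsto_atTop_mono (fun m => by omega : ∀ m, m - j ≤ m + 1 - j) (tendsto_sub_atTop_nat j)
  have hg : Tendsto (fun m : ℕ => (m : ℝ) * (a m / q - 1)) atTop (𝓝 (-t / (q - 1))) := by
    have h1 : Tendsto (fun m : ℕ => -((m : ℝ) * (q + 1 - s m)) * (a m / (q * (a m - 1)))) atTop
        (𝓝 (-t * (q / (q * (q - 1))))) :=
      hs.neg.mul (haq.div (tendsto_const_nhds.mul (haq.sub_const 1))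
        (mul_pos hq0 (by linarith)).ne')
    have : -t * (q / (q * (q - 1))) = -t / (q - 1) := by
      have : q - 1 ≠ 0 := by linarith
      field_simp
    rw [this] at h1
    refine h1.congr' ?_
    filter_upwards [habm, haq.eventually (lt_mem_nhds hq)] with m hm hm1
    have h2 : a m - 1 ≠ 0 := by linarith
    have h3 := hab m
    -- The equation `a ^ 2 - s a + q = 0`, rewritten around the limiting roots `q` and `1`, gives
    -- the first-order displacement of `a` without expanding a square root.
    have h4 : (a m - q) * (a m - 1) = -(q + 1 - s m) * a m := by
      rw [← h3]; nlinarith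
    have h5 : a m / q - 1 = (a m - q) / q := by field_simp
    rw [h5]
    rw [show -((m : ℝ) * (q + 1 - s m)) * (a m / (q * (a m - 1))) =
      m * ((-(q + 1 - s m) * a m) / (q * (a m - 1))) by ring, ← h4]
    field_simp
  have hexp : Tendsto (fun m : ℕ => (a m / q) ^ m) atTop (𝓝 (Real.exp (-t / (q - 1)))) := by
    simpa using Real.tendsto_one_add_pow_exp_of_tendsto hg
  have haq1 : Tendsto (fun m => a m / q) atTop (𝓝 1) := by
    simpa [hq0.ne'] using haq.div_const q
  have hmain : Tendsto (fun m : ℕ => (a m / q) ^ (m + 1 - j)) atTop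
      (𝓝 (Real.exp (-t / (q - 1)))) := by
    have h1 : Tendsto (fun m : ℕ => (a m / q) ^ m * (a m / q) / (a m / q) ^ j) atTop
        (𝓝 (Real.exp (-t / (q - 1)) * 1 / 1 ^ j)) :=
      (hexp.mul haq1).div (haq1.pow j) (by simp)
    simp only [mul_one, one_pow, div_one] at h1
    refine h1.congr' ?_
    filter_upwards [eventually_ge_atTop j, haq1.eventually (lt_mem_nhds zero_lt_one)] with m hm h0
    rw [← pow_succ, div_eq_iff (pow_pos h0 j).ne', ← pow_add]
    congr 1
    omega
  have hminor : Tendsto (fun m : ℕ => (b m / q) ^ (m + 1 - j)) atTop (𝓝 0) := by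
    have hbq1 : Tendsto (fun m => |b m / q|) atTop (𝓝 (1 / q)) := by
      have := (hbq.div_const q).abs
      rwa [abs_of_pos (by positivity : (0 : ℝ) < 1 / q)] at this
    obtain ⟨c, hc1, hc2⟩ := exists_between ((div_lt_one hq0).2 hq)
    have hc0 : 0 ≤ c := le_trans (by positivity) hc1.le
    refine squeeze_zero_norm' ?_ ((tendsto_pow_atTop_nhds_zero_of_lt_one hc0 hc2).comp hsub)
    filter_upwards [hbq1.eventually (gt_mem_nhds hc1)] with m hm
    rw [norm_pow, Real.norm_eq_abs]
    exact pow_le_pow_left₀ (abs_nonneg _) hm.le _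
  have := hmain.add hminor
  rw [add_zero] at this
  refine this.congr' ?_
  filter_upwards [habm] with m hm
  rw [powerSum_eq_add_pow (hab m) hm, add_div, div_pow (a m), div_pow (b m)]

end PowerSum

theorem tendsto_nat_mul_two_sub_two_cos (x : ℝ) :
    Tendsto (fun m : ℕ => (m : ℝ) * (2 - 2 * Real.cos ((Real.sqrt m)⁻¹ * x))) atTop
      (𝓝 (x ^ 2)) := by
  have h0 : Tendsto (fun m : ℕ => (Real.sqrt m)⁻¹ * x / 2) atTop (𝓝 0) := by
    have : Tendsto (fun m : ℕ => (Real.sqrt m)⁻¹) atTop (𝓝 0) :=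
      tendsto_inv_atTop_zero.comp (Real.tendsto_sqrt_atTop.comp tendsto_natCast_atTop_atTop)
    simpa using (this.mul_const x).div_const 2
  -- Writing `2 - 2 cos` as a squared sine, `sinc` handles `x = 0` without a separate case.
  have h1 : Tendsto (fun m : ℕ => (x * Real.sinc ((Real.sqrt m)⁻¹ * x / 2)) ^ 2) atTop
      (𝓝 ((x * Real.sinc 0) ^ 2)) :=
    (tendsto_const_nhds.mul ((Real.continuous_sinc.tendsto 0).comp h0)).pow 2
  rw [Real.sinc_zero, mul_one] at h1
  refine h1.congr' ?_
  filter_upwards [eventually_ge_atTop 1] with m hm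
  have hm0 : (0 : ℝ) < m := by exact_mod_cast hm
  have hs : Real.sqrt m ≠ 0 := (Real.sqrt_pos.2 hm0).ne'
  have hs2 : Real.sqrt m ^ 2 = m := Real.sq_sqrt hm0.le
  set y := (Real.sqrt m)⁻¹ * x / 2 with hy
  have hxy : x = 2 * Real.sqrt m * y := by rw [hy]; field_simp
  have hcos : Real.cos ((Real.sqrt m)⁻¹ * x) = 1 - 2 * Real.sin y ^ 2 := by
    rw [show (Real.sqrt m)⁻¹ * x = 2 * y by rw [hy]; ring, Real.cos_two_mul, Real.cos_sq']
    ring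
  have hsin : y * Real.sinc y = Real.sin y := by
    rcases eq_or_ne y 0 with h | h
    · simp [h]
    · rw [Real.sinc_of_ne_zero h]; field_simp
  rw [hcos, ← hsin]
  conv_lhs => rw [hxy]
  linear_combination (4 * y ^ 2 * Real.sinc y ^ 2) * hs2

/-! ### Character sums near the origin and on the half torus -/

section CharacterSumAsymptotics

variable {k : ℕ}

theorem tendsto_characterSum_div_pow (hk : 2 ≤ k) (φ : Fin k → ℝ) (j : ℕ) :
    Tendsto (fun m : ℕ => characterSum k (m + 1 - j) ((Real.sqrt m)⁻¹ • φ) /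
      (((2 * (k : ℝ) - 1) ^ (m + 1 - j) : ℝ) : ℂ)) atTop
      (𝓝 ((Real.exp (-(∑ i, φ i ^ 2) / (2 * ((k : ℝ) - 1))) : ℝ) : ℂ)) := by
  have hk' : (2 : ℝ) ≤ k := by exact_mod_cast hk
  set q : ℝ := 2 * k - 1 with hq
  have hq1 : 1 < q := by linarith
  set s : ℕ → ℝ := fun m => ∑ i, 2 * Real.cos ((Real.sqrt m)⁻¹ * φ i) with hs
  have hst : Tendsto (fun m : ℕ => (m : ℝ) * (q + 1 - s m)) atTop (𝓝 (∑ i, φ i ^ 2)) := by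
    have := tendsto_finsetSum Finset.univ fun i _ => tendsto_nat_mul_two_sub_two_cos (φ i)
    refine this.congr fun m => ?_
    rw [← Finset.mul_sum, Finset.sum_sub_distrib]
    simp [hs, hq, mul_comm]
  have h1 := tendsto_powerSum_div_pow hq1 hst j
  have hsub : Tendsto (fun m : ℕ => m + 1 - j) atTop atTop :=
    tendsto_atTop_mono (fun m => by omega : ∀ m, m - j ≤ m + 1 - j) (tendsto_sub_atTop_nat j)
  have h2 : Tendsto (fun m : ℕ => ((k : ℝ) - 1) * (1 + (-1) ^ (m + 1 - j)) / q ^ (m + 1 - j))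
      atTop (𝓝 0) := by
    have h3 : Tendsto (fun m : ℕ => ((k : ℝ) - 1) * 2 * (q⁻¹) ^ (m + 1 - j)) atTop (𝓝 0) := by
      simpa using ((tendsto_pow_atTop_nhds_zero_of_lt_one (by positivity)
        (inv_lt_one_of_one_lt₀ hq1)).comp hsub).const_mul (((k : ℝ) - 1) * 2)
    refine squeeze_zero_norm (fun m => ?_) h3
    rw [norm_div, norm_mul, inv_pow, div_eq_mul_inv, Real.norm_eq_abs, Real.norm_eq_abs,
      Real.norm_eq_abs, abs_of_pos (by linarith : (0 : ℝ) < k - 1),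
      abs_of_pos (by positivity : 0 < q ^ (m + 1 - j))]
    have : |1 + (-1 : ℝ) ^ (m + 1 - j)| ≤ 2 := by
      rcases neg_one_pow_eq_or ℝ (m + 1 - j) with h | h <;> rw [h] <;> norm_num
    gcongr
    linarith
  have h4 := h1.add h2
  rw [add_zero, show q - 1 = 2 * ((k : ℝ) - 1) by rw [hq]; ring] at h4
  refine ((Complex.continuous_ofReal.tendsto _).comp h4).congr' ?_
  filter_upwards [eventually_ge_atTop j] with m hm
  rw [characterSum_eq _ (by omega)]
  simp only [Function.comp, hs, hq, Pi.smul_apply, smul_eq_mul]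
  push_cast
  rw [add_div]

/-- The half-widths of a fundamental box for the even sublattice. -/
noncomputable def halfWidth (i : Fin k) : ℝ := if (i : ℕ) = 0 then Real.pi / 2 else Real.pi

theorem halfWidth_pos (i : Fin k) : 0 < halfWidth i := by
  unfold halfWidth
  split_ifs <;> positivity

theorem halfWidth_le (i : Fin k) : halfWidth i ≤ Real.pi := by
  unfold halfWidth
  split_ifs <;> linarith [Real.pi_pos]

/-- A fundamental domain for the characters of the even sublattice of `ℤ ^ k`. -/
def halfTorus (k : ℕ) : Set (Fin k → ℝ) :=
  Set.univ.pi fun i => Set.Ioc (-halfWidth i) (halfWidth i)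

theorem sum_sq_le_of_mem_halfTorus {θ : Fin k → ℝ} (hθ : θ ∈ halfTorus k) :
    ∑ i, θ i ^ 2 ≤ k * Real.pi ^ 2 := by
  calc ∑ i, θ i ^ 2 ≤ ∑ _i : Fin k, Real.pi ^ 2 := by
        refine Finset.sum_le_sum fun i _ => ?_
        have h := hθ i (Set.mem_univ i)
        have := halfWidth_le i
        exact sq_le_sq' (by linarith [h.1]) (by linarith [h.2])
    _ = k * Real.pi ^ 2 := by simp

/-- A two-sided bound is needed, since a sum near `-k` would also produce a root of modulus near
`q`. The halved first coordinate keeps one cosine nonnegative, so the sum is at least `-(k - 1)`;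
the upper bound is `cos x ≤ 1 - 2 x² / π²`. -/
theorem abs_sum_cos_le_of_mem_halfTorus (hk : 2 ≤ k) {θ : Fin k → ℝ} (hθ : θ ∈ halfTorus k) :
    |∑ i, Real.cos (θ i)| ≤ k - (∑ i, θ i ^ 2) / (k * Real.pi ^ 2) := by
  have hk' : (2 : ℝ) ≤ k := by exact_mod_cast hk
  have hX := sum_sq_le_of_mem_halfTorus hθ
  have hpi : 0 < Real.pi ^ 2 := by positivity
  have habs : ∀ i, |θ i| ≤ halfWidth i := fun i =>
    abs_le.2 ⟨(hθ i (Set.mem_univ i)).1.le, (hθ i (Set.mem_univ i)).2⟩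
  rw [abs_le]
  constructor
  · have h1 : (∑ i, θ i ^ 2) / (k * Real.pi ^ 2) ≤ 1 := by
      rw [div_le_one (by positivity)]; exact hX
    let i₀ : Fin k := ⟨0, by omega⟩
    have h2 : ∑ i, -Real.cos (θ i) ≤ ∑ i, if i = i₀ then (0 : ℝ) else 1 := by
      refine Finset.sum_le_sum fun i _ => ?_
      split_ifs with h
      · subst h
        have h3 : |θ i₀| ≤ Real.pi / 2 := by simpa [halfWidth, i₀] using habs i₀
        rw [neg_nonpos]
        exact Real.cos_nonneg_of_mem_Icc (abs_le.1 h3)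
      · linarith [Real.neg_one_le_cos (θ i)]
    have h3 : ∑ i : Fin k, (if i = i₀ then (0 : ℝ) else 1) = k - 1 := by
      have : ∀ i : Fin k, (if i = i₀ then (0 : ℝ) else 1) = 1 - if i = i₀ then 1 else 0 := by
        intro i; split_ifs <;> simp
      simp [this, Finset.sum_sub_distrib]
    rw [Finset.sum_neg_distrib, h3] at h2
    linarith
  · have h1 : ∑ i, Real.cos (θ i) ≤ ∑ i, (1 - 2 / Real.pi ^ 2 * θ i ^ 2) :=
      Finset.sum_le_sum fun i _ =>
        Real.cos_le_one_sub_mul_cos_sq ((habs i).trans (halfWidth_le i))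
    rw [Finset.sum_sub_distrib, ← Finset.mul_sum] at h1
    simp only [Finset.sum_const, Finset.card_univ, Fintype.card_fin, nsmul_eq_mul, mul_one] at h1
    have h2 : (∑ i, θ i ^ 2) / (k * Real.pi ^ 2) ≤ 2 / Real.pi ^ 2 * ∑ i, θ i ^ 2 := by
      have h0 : 0 ≤ ∑ i, θ i ^ 2 := Finset.sum_nonneg fun i _ => sq_nonneg _
      rw [div_mul_eq_mul_div]
      apply div_le_div₀ (by positivity) (by linarith) hpi
      nlinarith
    linarith

/-- The exponential decay rate of the character sums on the half torus. -/
noncomputable def decayRate (k : ℕ) : ℝ := 1 / (3 * (2 * k - 1) * (k * Real.pi ^ 2))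

theorem decayRate_pos (hk : 2 ≤ k) : 0 < decayRate k := by
  have hk' : (2 : ℝ) ≤ k := by exact_mod_cast hk
  have : (0 : ℝ) < 2 * k - 1 := by linarith
  unfold decayRate
  positivity

/-- The constant `3/2` pays for lags: a word shorter by `j` letters loses `j` decay factors, costing
at most `(3/2) ^ j`, which the lag weights of order `3 ^ (-j)` absorb. -/
theorem exp_decayRate_le (hk : 2 ≤ k) {θ : Fin k → ℝ} (hθ : θ ∈ halfTorus k) :
    Real.exp (decayRate k * ∑ i, θ i ^ 2) ≤ 3 / 2 := by
  have hk' : (2 : ℝ) ≤ k := by exact_mod_cast hk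
  have hX := sum_sq_le_of_mem_halfTorus hθ
  have h1 : decayRate k * ∑ i, θ i ^ 2 ≤ 1 / 3 := by
    calc decayRate k * ∑ i, θ i ^ 2 ≤ decayRate k * (k * Real.pi ^ 2) := by
          gcongr; exact (decayRate_pos hk).le
      _ = 1 / (3 * (2 * k - 1)) := by
          have : (2 * k - 1 : ℝ) ≠ 0 := by linarith
          unfold decayRate; field_simp
      _ ≤ 1 / 3 := by
          apply one_div_le_one_div_of_le <;> linarith
  have h2 := Real.add_one_le_exp (-(decayRate k * ∑ i, θ i ^ 2))
  rw [Real.exp_neg] at h2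
  have h3 : 2 / 3 ≤ (Real.exp (decayRate k * ∑ i, θ i ^ 2))⁻¹ := by linarith
  have h4 := inv_anti₀ (by norm_num) h3
  rw [inv_inv] at h4
  linarith

/-- The radius `r = q exp (-decayRate * |θ|²)` is admissible in `abs_powerSum_le`: the exponential
is at least `2/3` and `q ≥ 3`, so `r ^ 2 ≥ q`, while the cosine bound controls the trace. As `r ≥
1`, the eigenvalues `±1` are absorbed in the constant. -/
theorem norm_characterSum_le (hk : 2 ≤ k) {θ : Fin k → ℝ} (hθ : θ ∈ halfTorus k) (n : ℕ) :
    ‖characterSum k n θ‖ ≤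
      (2 + 2 * k) * ((2 * (k : ℝ) - 1) * Real.exp (-(decayRate k * ∑ i, θ i ^ 2))) ^ n := by
  have hk' : (2 : ℝ) ≤ k := by exact_mod_cast hk
  set q : ℝ := 2 * k - 1 with hq
  have hq3 : 3 ≤ q := by linarith
  set X := ∑ i, θ i ^ 2 with hX
  have hX0 : 0 ≤ X := Finset.sum_nonneg fun i _ => sq_nonneg _
  set r := q * Real.exp (-(decayRate k * X)) with hr
  have hbX : 0 ≤ decayRate k * X := mul_nonneg (decayRate_pos hk).le hX0
  have he : 2 / 3 ≤ Real.exp (-(decayRate k * X)) := by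
    rw [Real.exp_neg]
    have := inv_anti₀ (Real.exp_pos _) (exp_decayRate_le hk hθ)
    norm_num at this ⊢
    exact this
  have hr2 : 2 * q / 3 ≤ r := by rw [hr]; nlinarith
  have hr1 : 1 ≤ r := by linarith
  have hr0 : 0 < r := by linarith
  have hrq : r ≤ q := by
    have : Real.exp (-(decayRate k * X)) ≤ 1 := Real.exp_le_one_iff.2 (by linarith)
    rw [hr]; nlinarith
  -- Length zero is separate: the empty word contributes `1`, whereas the trace would give `2k`.
  rcases Nat.eq_zero_or_pos n with rfl | hn
  · rw [characterSum_zero_left]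
    simp
    linarith
  rw [characterSum_eq n hn.ne', Complex.norm_real, Real.norm_eq_abs]
  have hS : |∑ i, 2 * Real.cos (θ i)| ≤ r + q / r := by
    rw [← Finset.mul_sum, abs_mul, abs_two]
    have h1 := abs_sum_cos_le_of_mem_halfTorus hk hθ
    have h2 : 1 ≤ q / r := by rw [le_div_iff₀ hr0]; linarith
    have h3 : q - q * (decayRate k * X) ≤ r := by
      have := Real.add_one_le_exp (-(decayRate k * X))
      rw [hr]; nlinarith
    have h4 : q * (decayRate k * X) ≤ 2 * (X / (k * Real.pi ^ 2)) := by
      have : q * (decayRate k * X) = X / (k * Real.pi ^ 2) / 3 := by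
        have : q ≠ 0 := by linarith
        rw [decayRate, ← hq]; field_simp
      rw [this]
      have : 0 ≤ X / (k * Real.pi ^ 2) := by positivity
      linarith
    linarith
  have h1 := abs_powerSum_le hr0 (by linarith : 0 < q) (by nlinarith) hS n
  have h2 : |((k : ℝ) - 1) * (1 + (-1) ^ n)| ≤ 2 * k * r ^ n := by
    have h3 : |1 + (-1 : ℝ) ^ n| ≤ 2 := by
      rcases neg_one_pow_eq_or ℝ n with h | h <;> rw [h] <;> norm_num
    have h4 : 1 ≤ r ^ n := one_le_pow₀ hr1
    rw [abs_mul, abs_of_pos (by linarith : (0 : ℝ) < k - 1)]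
    nlinarith
  calc _ ≤ _ := abs_add_le _ _
    _ ≤ 2 * r ^ n + 2 * k * r ^ n := add_le_add h1 h2
    _ = _ := by ring

end CharacterSumAsymptotics

end FreeGroupLog

namespace FreeGroupLog

open Filter Topology MeasureTheory

/-! ### Averaged counts as weighted sums over spheres -/

section Counting

variable {k : ℕ}

open scoped Classical in
/-- The number of cyclically reduced elements of length `n` with logarithm vector `β`. -/
noncomputable def sphereCount (n : ℕ) (β : Fin k → ℤ) : ℕ :=
  ((cyclicallyReducedOfNorm k n).filter fun γ => discreteLog γ = β).card

theorem cyclicallyReducedCount_eq_sum (β : Fin k → ℤ) (m : ℕ) :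
    cyclicallyReducedCount β m = ∑ n ∈ Finset.range (m + 1), sphereCount n β := by
  classical
  have : cyclicallyReducedSet β m = ↑((Finset.range (m + 1)).biUnion fun n =>
      (cyclicallyReducedOfNorm k n).filter fun γ => discreteLog γ = β) := by
    ext γ
    simp only [cyclicallyReducedSet, Set.mem_ofPred_eq, Finset.coe_biUnion, Set.mem_iUnion,
      Finset.mem_coe, Finset.mem_range, Finset.mem_filter, mem_cyclicallyReducedOfNorm]
    constructor
    · rintro ⟨h1, h2, h3⟩
      exact ⟨γ.norm, by omega, ⟨h1, rfl⟩, h3⟩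
    · rintro ⟨n, hn, ⟨h1, h2⟩, h3⟩
      exact ⟨h1, by omega, h3⟩
  rw [cyclicallyReducedCount, this, Set.ncard_coe_finset, Finset.card_biUnion]
  · rfl
  · intro i _ j _ hij
    rw [Function.onFun, Finset.disjoint_left]
    intro γ hi hj
    simp only [Finset.mem_filter, mem_cyclicallyReducedOfNorm] at hi hj
    exact hij (hi.1.2.symm.trans hj.1.2)

theorem sphereCount_eq_zero {n : ℕ} {β : Fin k → ℤ} (h : (∑ i, β i) % 2 ≠ (n : ℤ) % 2) :
    sphereCount n β = 0 := by
  classical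
  rw [sphereCount, Finset.card_eq_zero, Finset.filter_eq_empty_iff]
  rintro γ hγ rfl
  rw [sum_discreteLog_emod_two, (mem_cyclicallyReducedOfNorm.1 hγ).2] at h
  exact h rfl

/-- The weight of the words of length `m + 1 - j` in the averaged count at `m`. -/
noncomputable def lagWeight (q : ℝ) (j : ℕ) : ℝ :=
  if j = 0 then (q - 1) / (2 * q) else (q ^ 2 - 1) / (2 * q ^ (j + 1))

/-- The average of the normalized counts at `m` and `m + 1`. -/
noncomputable def averagedCount (m : ℕ) (β : Fin k → ℤ) : ℝ :=
  (1 / 2) * ((cyclicallyReducedCount β m : ℝ) /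
      ((2 * (k : ℝ) - 1) ^ (m + 1) / ((2 * (k : ℝ) - 1) - 1)) +
    (cyclicallyReducedCount β (m + 1) : ℝ) /
      ((2 * (k : ℝ) - 1) ^ (m + 2) / ((2 * (k : ℝ) - 1) - 1)))

theorem averagedCount_nonneg (hk : 2 ≤ k) (m : ℕ) (β : Fin k → ℤ) : 0 ≤ averagedCount m β := by
  have hk' : (2 : ℝ) ≤ k := by exact_mod_cast hk
  have h1 : (0 : ℝ) < 2 * k - 1 := by linarith
  have h2 : (0 : ℝ) < 2 * k - 1 - 1 := by linarith
  unfold averagedCount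
  positivity

/-- Lengths at most `m` occur in both counts, with joint coefficient `(q ^ 2 - 1) / (2 q ^ (m +
2))`; length `m + 1` occurs only in the second. This is the origin of the two cases of `lagWeight`.
-/
theorem averagedCount_eq_sum (hk : 2 ≤ k) (m : ℕ) (β : Fin k → ℤ) :
    averagedCount m β = ∑ j ∈ Finset.range (m + 2), lagWeight (2 * k - 1) j *
      ((sphereCount (m + 1 - j) β : ℝ) / (2 * (k : ℝ) - 1) ^ (m + 1 - j)) := by
  have hk' : (2 : ℝ) ≤ k := by exact_mod_cast hk
  rw [averagedCount]
  set q : ℝ := 2 * k - 1 with hq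
  have hq0 : q ≠ 0 := by linarith
  have hq1 : q - 1 ≠ 0 := by linarith
  rw [cyclicallyReducedCount_eq_sum, cyclicallyReducedCount_eq_sum β (m + 1),
    Finset.sum_range_succ (fun n => sphereCount n β) (m + 1),
    ← Finset.sum_range_reflect (fun n => sphereCount n β) (m + 1), Finset.sum_range_succ' _ (m + 1)]
  simp only [Nat.add_sub_cancel, Nat.add_sub_add_right, Nat.sub_zero, Nat.cast_sum, Nat.cast_add]
  have hj : ∀ j ∈ Finset.range (m + 1), lagWeight q (j + 1) *
      ((sphereCount (m - j) β : ℝ) / q ^ (m - j)) =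
      ((q ^ 2 - 1) / (2 * q ^ (m + 2))) * (sphereCount (m - j) β : ℝ) := by
    intro j hj
    have hjm : j ≤ m := by simpa [Nat.lt_succ_iff] using hj
    have e : m + 2 = (m - j) + (j + 1 + 1) := by omega
    rw [lagWeight, if_neg (by omega), e, pow_add]
    field_simp
    ring
  rw [Finset.sum_congr rfl hj, ← Finset.mul_sum, lagWeight, if_pos rfl]
  generalize ∑ x ∈ Finset.range (m + 1), (sphereCount (m - x) β : ℝ) = T
  field_simp
  ring

end Counting

/-! ### Summability and parity balance of the lag weights -/

section LagWeight

variable {q : ℝ}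

theorem lagWeight_nonneg (hq : 1 < q) (j : ℕ) : 0 ≤ lagWeight q j := by
  have h0 : 0 < q := by linarith
  have h1 : 0 ≤ q - 1 := by linarith
  have h2 : 0 ≤ q ^ 2 - 1 := by nlinarith
  unfold lagWeight
  split_ifs <;> positivity

theorem lagWeight_le (hq : 3 ≤ q) (j : ℕ) : lagWeight q j ≤ q * (1 / 3) ^ j := by
  have h0 : 0 < q := by linarith
  unfold lagWeight
  split_ifs with h
  · subst h
    rw [div_le_iff₀ (by positivity)]
    nlinarith
  · have h1 : q * (1 / q) ^ j ≤ q * (1 / 3) ^ j := by gcongr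
    refine le_trans ?_ h1
    rw [div_le_iff₀ (by positivity), pow_succ q j, one_div, inv_pow]
    have h2 : 0 < q ^ j := by positivity
    field_simp
    nlinarith [mul_pos h0 h2]

theorem summable_lagWeight (hq : 3 ≤ q) : Summable (lagWeight q) :=
  Summable.of_nonneg_of_le (lagWeight_nonneg (by linarith)) (lagWeight_le hq)
    ((summable_geometric_of_lt_one (by norm_num) (by norm_num)).mul_left q)

/-- This is the purpose of averaging over `m` and `m + 1`: a single cumulative count would weight
the two parities in the ratio `q : 1`. -/
theorem tsum_lagWeight_parity (hq : 3 ≤ q) (ε : ℕ) (hε : ε < 2) :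
    ∑' j, (if j % 2 = ε then lagWeight q j else 0) = 1 / 2 := by
  have h0 : 0 < q := by linarith
  have hsum : Summable fun j => if j % 2 = ε then lagWeight q j else 0 := by
    refine Summable.of_nonneg_of_le (fun j => ?_) (fun j => ?_) (summable_lagWeight hq)
    · split_ifs
      · exact lagWeight_nonneg (by linarith) j
      · exact le_rfl
    · split_ifs
      · exact le_rfl
      · exact lagWeight_nonneg (by linarith) j
  have hpart : ∀ N : ℕ, ∑ j ∈ Finset.range (2 * (N + 1)),
      (if j % 2 = ε then lagWeight q j else 0) =
        1 / 2 - (if ε = 0 then q else 1) / 2 * (1 / q) ^ (2 * (N + 1)) := by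
    intro N
    induction N with
    | zero =>
      interval_cases ε <;> simp [Finset.sum_range_succ, lagWeight] <;> field_simp
    | succ N ih =>
      rw [show 2 * (N + 1 + 1) = 2 * (N + 1) + 1 + 1 by ring, Finset.sum_range_succ,
        Finset.sum_range_succ, ih]
      have e1 : (2 * (N + 1)) % 2 = 0 := by omega
      have e2 : (2 * (N + 1) + 1) % 2 = 1 := by omega
      simp only [e1, e2, lagWeight, one_div, inv_pow]
      interval_cases ε
      · simp
        field_simp
        ring
      · simp
        field_simp
        ring
  have h1 := (hsum.hasSum.tendsto_sum_nat).comp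
    (tendsto_atTop_mono (fun N => by omega : ∀ N, N ≤ 2 * (N + 1)) tendsto_id)
  have h2 : Tendsto (fun N : ℕ => 1 / 2 - (if ε = 0 then q else 1) / 2 * (1 / q) ^ (2 * (N + 1)))
      atTop (𝓝 (1 / 2 - (if ε = 0 then q else 1) / 2 * 0)) := by
    refine tendsto_const_nhds.sub (tendsto_const_nhds.mul ?_)
    exact (tendsto_pow_atTop_nhds_zero_of_lt_one (by positivity)
      ((div_lt_one h0).2 (by linarith))).comp
      (tendsto_atTop_mono (fun N => by omega : ∀ N, N ≤ 2 * (N + 1)) tendsto_id)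
  rw [mul_zero, sub_zero] at h2
  exact tendsto_nhds_unique h1 (h2.congr fun N => (hpart N).symm)

end LagWeight

/-! ### Fourier inversion on the even sublattice -/

section FourierInversion

variable {k : ℕ}

theorem measurableSet_halfTorus : MeasurableSet (halfTorus k) :=
  MeasurableSet.univ_pi fun _ => measurableSet_Ioc

theorem integral_exp_mul_int_eq_zero {a : ℝ} (ha : 0 ≤ a) {d : ℤ} (hd : d ≠ 0)
    (h : Complex.exp (2 * Complex.I * d * a) = 1) :
    ∫ x in Set.Ioc (-a) a, Complex.exp (Complex.I * ((x : ℂ) * d)) = 0 := by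
  rw [← intervalIntegral.integral_of_le (by linarith)]
  have hc : Complex.I * d ≠ 0 := mul_ne_zero Complex.I_ne_zero (by exact_mod_cast hd)
  have : ∀ x : ℝ, Complex.exp (Complex.I * ((x : ℂ) * d)) = Complex.exp (Complex.I * d * x) := by
    intro x; ring_nf
  simp only [this]
  rw [integral_exp_mul_complex hc]
  have h2 : Complex.exp (Complex.I * d * a) =
      Complex.exp (2 * Complex.I * d * a) * Complex.exp (Complex.I * d * ((-a : ℝ) : ℂ)) := by
    rw [← Complex.exp_add]
    congr 1
    push_cast
    ring
  rw [h2, h, one_mul, sub_self, zero_div]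

theorem prod_two_mul_halfWidth (hk : 2 ≤ k) :
    ∏ i : Fin k, (2 * halfWidth i) = (2 * Real.pi) ^ k / 2 := by
  obtain ⟨n, rfl⟩ : ∃ n, k = n + 1 := ⟨k - 1, by omega⟩
  rw [Fin.prod_univ_succ]
  simp [halfWidth]
  ring

/-- Orthogonality of the characters of the even sublattice on the half torus. -/
theorem integral_latticeChar (hk : 2 ≤ k) (δ : Fin k → ℤ) (hδ : (∑ i, δ i) % 2 = 0) :
    ∫ θ in halfTorus k, latticeChar θ δ = if δ = 0 then (((2 * Real.pi) ^ k / 2 : ℝ) : ℂ) else 0 := by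
  have hprod : ∀ θ : Fin k → ℝ,
      latticeChar θ δ = ∏ i, Complex.exp (Complex.I * ((θ i : ℂ) * δ i)) := by
    intro θ
    rw [latticeChar, Finset.mul_sum, Complex.exp_sum]
  simp only [hprod]
  rw [halfTorus, volume_pi, Measure.restrict_pi_pi,
    integral_fintype_prod_eq_prod (fun i (x : ℝ) => Complex.exp (Complex.I * ((x : ℂ) * δ i)))]
  split_ifs with h
  · subst h
    rw [← prod_two_mul_halfWidth hk]
    push_cast
    refine Finset.prod_congr rfl fun i _ => ?_
    have := halfWidth_pos i
    simp only [Pi.zero_apply, Int.cast_zero, mul_zero, Complex.exp_zero, integral_const,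
      MeasurableSet.univ, measureReal_restrict_apply, Set.univ_inter, Real.volume_real_Ioc]
    rw [max_eq_left (by linarith)]
    simp
    ring
  -- Either a coordinate of full width `2π` is nonzero, or only the first one is; the latter is then
  -- even, so its interval of length `π` covers whole periods.
  · obtain ⟨i, hi, hi'⟩ : ∃ i, δ i ≠ 0 ∧ ((i : ℕ) ≠ 0 ∨ δ i % 2 = 0) := by
      by_cases hex : ∃ i : Fin k, δ i ≠ 0 ∧ (i : ℕ) ≠ 0
      · obtain ⟨i, h1, h2⟩ := hex
        exact ⟨i, h1, Or.inl h2⟩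
      · push Not at hex
        let i₀ : Fin k := ⟨0, by omega⟩
        have hz : ∀ i, i ≠ i₀ → δ i = 0 := by
          intro i hi
          by_contra hne
          exact hi (Fin.ext (hex i hne))
        have hs : ∑ i, δ i = δ i₀ := Finset.sum_eq_single i₀ (fun i _ hi => hz i hi) (by simp)
        refine ⟨i₀, fun h0 => h ?_, Or.inr (by rw [← hs]; exact hδ)⟩
        ext i
        rcases eq_or_ne i i₀ with rfl | hi
        · exact h0
        · exact hz i hi
    refine Finset.prod_eq_zero (Finset.mem_univ i)
      (integral_exp_mul_int_eq_zero (halfWidth_pos i).le hi ?_)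
    rcases hi' with h1 | h1
    · rw [halfWidth, if_neg h1, show 2 * Complex.I * (δ i : ℂ) * (Real.pi : ℂ) =
        (δ i : ℂ) * (2 * Real.pi * Complex.I) by ring]
      exact Complex.exp_int_mul_two_pi_mul_I _
    · obtain ⟨e, he⟩ := Int.dvd_of_emod_eq_zero h1
      unfold halfWidth
      split_ifs
      · rw [he, show 2 * Complex.I * ((2 * e : ℤ) : ℂ) * ((Real.pi / 2 : ℝ) : ℂ) =
          (e : ℂ) * (2 * Real.pi * Complex.I) by push_cast; ring]
        exact Complex.exp_int_mul_two_pi_mul_I _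
      · rw [show 2 * Complex.I * (δ i : ℂ) * (Real.pi : ℂ) =
          (δ i : ℂ) * (2 * Real.pi * Complex.I) by ring]
        exact Complex.exp_int_mul_two_pi_mul_I _

theorem integrableOn_halfTorus {f : (Fin k → ℝ) → ℂ} (hf : Continuous f) :
    IntegrableOn f (halfTorus k) := by
  refine (hf.continuousOn.integrableOn_compact
    (isCompact_univ_pi fun i => isCompact_Icc (a := -halfWidth i) (b := halfWidth i))).mono_set ?_
  exact Set.pi_mono fun i _ => Set.Ioc_subset_Icc_self

theorem sphereCount_eq_integral (hk : 2 ≤ k) {n : ℕ} {β : Fin k → ℤ}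
    (h : (∑ i, β i) % 2 = (n : ℤ) % 2) :
    (sphereCount n β : ℂ) = ((2 / (2 * Real.pi) ^ k : ℝ) : ℂ) *
      ∫ θ in halfTorus k, characterSum k n θ * latticeChar θ (-β) := by
  classical
  have h1 : ∀ θ : Fin k → ℝ, characterSum k n θ * latticeChar θ (-β) =
      ∑ γ ∈ cyclicallyReducedOfNorm k n, latticeChar θ (discreteLog γ - β) := by
    intro θ
    rw [characterSum, Finset.sum_mul]
    simp only [sub_eq_add_neg, latticeChar_add]
  simp only [h1]
  rw [integral_finsetSum _ fun γ _ => integrableOn_halfTorus (continuous_latticeChar _)]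
  have h2 : ∀ γ ∈ cyclicallyReducedOfNorm k n,
      ∫ θ in halfTorus k, latticeChar θ (discreteLog γ - β) =
        if discreteLog γ = β then (((2 * Real.pi) ^ k / 2 : ℝ) : ℂ) else 0 := by
    intro γ hγ
    rw [integral_latticeChar hk]
    · simp only [sub_eq_zero]
    · have h3 := sum_discreteLog_emod_two γ
      rw [(mem_cyclicallyReducedOfNorm.1 hγ).2] at h3
      simp only [Pi.sub_apply, Finset.sum_sub_distrib]
      omega
  rw [Finset.sum_congr rfl h2, ← Finset.sum_filter, Finset.sum_const, sphereCount, nsmul_eq_mul]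
  have : ((2 * Real.pi : ℝ) : ℂ) ^ k ≠ 0 := by
    have := Real.pi_pos
    exact_mod_cast (by positivity : (2 * Real.pi) ^ k ≠ 0)
  push_cast at this ⊢
  field_simp

/-- The characteristic function of the lags `j ≡ ε` in the averaged count at `m`. -/
noncomputable def parityCharFun (k m ε : ℕ) (θ : Fin k → ℝ) : ℂ :=
  ∑ j ∈ Finset.range (m + 2), if j % 2 = ε then
    ((lagWeight (2 * k - 1) j : ℝ) : ℂ) *
      (characterSum k (m + 1 - j) θ / (((2 * (k : ℝ) - 1) ^ (m + 1 - j) : ℝ) : ℂ)) else 0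

theorem continuous_parityCharFun (k m ε : ℕ) : Continuous (parityCharFun k m ε) := by
  unfold parityCharFun
  refine continuous_finsetSum _ fun j _ => ?_
  split_ifs
  · exact continuous_const.mul ((continuous_characterSum _ _).div_const _)
  · exact continuous_const

/-- Lags of the wrong parity have no words over `β`, so only one parity class enters, and on it
inversion over the half torus is valid. -/
theorem averagedCount_eq_integral (hk : 2 ≤ k) {m ε : ℕ} {β : Fin k → ℤ}
    (h : ((m : ℤ) + 1 - ∑ i, β i) % 2 = ε) :
    (averagedCount m β : ℂ) = ((2 / (2 * Real.pi) ^ k : ℝ) : ℂ) *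
      ∫ θ in halfTorus k, parityCharFun k m ε θ * latticeChar θ (-β) := by
  have h1 : ∀ θ : Fin k → ℝ, parityCharFun k m ε θ * latticeChar θ (-β) =
      ∑ j ∈ Finset.range (m + 2), (if j % 2 = ε then ((lagWeight (2 * k - 1) j : ℝ) : ℂ) /
        (((2 * (k : ℝ) - 1) ^ (m + 1 - j) : ℝ) : ℂ) else 0) *
          (characterSum k (m + 1 - j) θ * latticeChar θ (-β)) := by
    intro θ
    rw [parityCharFun, Finset.sum_mul]
    refine Finset.sum_congr rfl fun j _ => ?_
    split_ifs <;> ring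
  simp only [h1]
  have h2 : ∀ j, IntegrableOn (fun θ : Fin k → ℝ =>
      characterSum k (m + 1 - j) θ * latticeChar θ (-β)) (halfTorus k) := fun j =>
    integrableOn_halfTorus ((continuous_characterSum _ _).mul (continuous_latticeChar _))
  rw [integral_finsetSum _ fun j _ => (h2 j).const_mul _, averagedCount_eq_sum hk, Finset.mul_sum]
  push_cast
  refine Finset.sum_congr rfl fun j hj => ?_
  rw [integral_const_mul]
  have hj' : j ≤ m + 1 := by simpa [Nat.lt_succ_iff] using hj
  split_ifs with hjε
  · rw [sphereCount_eq_integral hk]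
    · push_cast
      ring
    · omega
  · rw [sphereCount_eq_zero]
    · simp
    · omega

end FourierInversion

end FreeGroupLog

namespace FreeGroupLog

open Filter Topology MeasureTheory

/-! ### Uniform local limit theorem -/

section LocalLimit

variable {k : ℕ}

theorem three_le_two_mul_sub_one (hk : 2 ≤ k) : (3 : ℝ) ≤ 2 * k - 1 := by
  have hk' : (2 : ℝ) ≤ k := by exact_mod_cast hk
  linarith

theorem norm_characterSum_div_pow_le (hk : 2 ≤ k) {θ : Fin k → ℝ} (hθ : θ ∈ halfTorus k)
    (n : ℕ) : ‖characterSum k n θ / (((2 * (k : ℝ) - 1) ^ n : ℝ) : ℂ)‖ ≤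
      (2 + 2 * k) * Real.exp (-(decayRate k * ∑ i, θ i ^ 2)) ^ n := by
  have hq := three_le_two_mul_sub_one hk
  have hq0 : (0 : ℝ) < (2 * (k : ℝ) - 1) ^ n := by positivity
  rw [norm_div, Complex.norm_real, Real.norm_eq_abs, abs_of_pos hq0, div_le_iff₀ hq0]
  refine (norm_characterSum_le hk hθ n).trans (le_of_eq ?_)
  rw [mul_pow]
  ring

theorem zero_mem_interior_halfTorus : halfTorus k ∈ 𝓝 (0 : Fin k → ℝ) := by
  refine set_pi_mem_nhds Set.finite_univ fun i _ => Ioc_mem_nhds ?_ (halfWidth_pos i)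
  simpa using halfWidth_pos i

theorem eventually_inv_sqrt_smul_mem_halfTorus (φ : Fin k → ℝ) :
    ∀ᶠ m : ℕ in atTop, (Real.sqrt m)⁻¹ • φ ∈ halfTorus k := by
  have h : Tendsto (fun m : ℕ => (Real.sqrt m)⁻¹) atTop (𝓝 0) :=
    tendsto_inv_atTop_zero.comp (Real.tendsto_sqrt_atTop.comp tendsto_natCast_atTop_atTop)
  have h1 : Tendsto (fun m : ℕ => (Real.sqrt m)⁻¹ • φ) atTop (𝓝 ((0 : ℝ) • φ)) :=
    h.smul_const φ
  rw [zero_smul] at h1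
  exact h1 zero_mem_interior_halfTorus

/-- Every fixed lag has the same Gaussian limit and the weights of one parity sum to `1/2`;
dominated convergence over lags exchanges sum and limit. -/
theorem tendsto_parityCharFun (hk : 2 ≤ k) {ε : ℕ} (hε : ε < 2) (φ : Fin k → ℝ) :
    Tendsto (fun m : ℕ => parityCharFun k m ε ((Real.sqrt m)⁻¹ • φ)) atTop
      (𝓝 ((1 / 2 * Real.exp (-(∑ i, φ i ^ 2) / (2 * ((k : ℝ) - 1))) : ℝ) : ℂ)) := by
  have hq := three_le_two_mul_sub_one hk
  set E := Real.exp (-(∑ i, φ i ^ 2) / (2 * ((k : ℝ) - 1))) with hE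
  let f : ℕ → ℕ → ℂ := fun m j => if j < m + 2 ∧ j % 2 = ε then
    ((lagWeight (2 * k - 1) j : ℝ) : ℂ) *
      (characterSum k (m + 1 - j) ((Real.sqrt m)⁻¹ • φ) /
        (((2 * (k : ℝ) - 1) ^ (m + 1 - j) : ℝ) : ℂ)) else 0
  let g : ℕ → ℂ := fun j => if j % 2 = ε then ((lagWeight (2 * k - 1) j : ℝ) : ℂ) * (E : ℂ) else 0
  have hf : ∀ m, parityCharFun k m ε ((Real.sqrt m)⁻¹ • φ) = ∑' j, f m j := by
    intro m
    rw [tsum_eq_sum (s := Finset.range (m + 2))]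
    · refine Finset.sum_congr rfl fun j hj => ?_
      simp only [f, Finset.mem_range.1 hj, true_and]
    · intro j hj
      simp only [Finset.mem_range] at hj
      simp only [f, hj, false_and, if_false]
  have hg : ∑' j, g j = ((1 / 2 * E : ℝ) : ℂ) := by
    rw [← tsum_lagWeight_parity hq ε hε, ← tsum_mul_right, Complex.ofReal_tsum]
    refine tsum_congr fun j => ?_
    simp only [g]
    split_ifs <;> simp
  rw [← hg]
  simp only [hf]
  refine tendsto_tsum_of_dominated_convergence
    (bound := fun j => lagWeight (2 * k - 1) j * (2 + 2 * k))
    ((summable_lagWeight hq).mul_right _) (fun j => ?_) ?_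
  · simp only [g]
    split_ifs with hj
    · refine ((tendsto_characterSum_div_pow hk φ j).const_mul _).congr' ?_
      filter_upwards [eventually_ge_atTop j] with m hm
      simp only [f]
      rw [if_pos ⟨by omega, hj⟩]
    · simp [f, hj]
  · filter_upwards [eventually_inv_sqrt_smul_mem_halfTorus φ] with m hm j
    have hw := lagWeight_nonneg (by linarith : (1 : ℝ) < 2 * k - 1) j
    simp only [f]
    split_ifs with hj
    · rw [norm_mul, Complex.norm_real, Real.norm_eq_abs, abs_of_nonneg hw]
      refine mul_le_mul_of_nonneg_left ?_ hw
      refine (norm_characterSum_div_pow_le hk hm _).trans ?_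
      refine mul_le_of_le_one_right (by positivity) (pow_le_one₀ (Real.exp_pos _).le ?_)
      rw [Real.exp_le_one_iff, neg_nonpos]
      exact mul_nonneg (decayRate_pos hk).le (Finset.sum_nonneg fun i _ => sq_nonneg _)
    · rw [norm_zero]
      positivity

/-- The truncated characteristic function at scale `√m`. -/
noncomputable def scaledCharFun (k m ε : ℕ) (φ : Fin k → ℝ) : ℂ :=
  (halfTorus k).indicator (parityCharFun k m ε) ((Real.sqrt m)⁻¹ • φ)

theorem measurable_scaledCharFun (k m ε : ℕ) : Measurable (scaledCharFun k m ε) :=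
  ((continuous_parityCharFun k m ε).measurable.indicator measurableSet_halfTorus).comp
    (measurable_const_smul _)

theorem norm_scaledCharFun_le (hk : 2 ≤ k) {m : ℕ} (hm : m ≠ 0) (ε : ℕ) (φ : Fin k → ℝ) :
    ‖scaledCharFun k m ε φ‖ ≤
      2 * (2 * k - 1) * (2 + 2 * k) * Real.exp (-(decayRate k * ∑ i, φ i ^ 2)) := by
  have hq := three_le_two_mul_sub_one hk
  have hb := decayRate_pos hk
  rw [scaledCharFun]
  by_cases hθ : (Real.sqrt m)⁻¹ • φ ∈ halfTorus k
  swap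
  · rw [Set.indicator_of_notMem hθ, norm_zero]
    have : (0 : ℝ) < 2 * k - 1 := by linarith
    positivity
  rw [Set.indicator_of_mem hθ]
  set θ := (Real.sqrt m)⁻¹ • φ with hθdef
  set X := ∑ i, θ i ^ 2 with hX
  have hX0 : 0 ≤ X := Finset.sum_nonneg fun i _ => sq_nonneg _
  have hm0 : (0 : ℝ) < m := by positivity
  have hXφ : ∑ i, φ i ^ 2 = m * X := by
    rw [hX, Finset.mul_sum]
    refine Finset.sum_congr rfl fun i _ => ?_
    simp only [hθdef, Pi.smul_apply, smul_eq_mul, mul_pow, inv_pow, Real.sq_sqrt hm0.le]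
    field_simp
  have hexp := exp_decayRate_le hk hθ
  have hterm : ∀ j ∈ Finset.range (m + 2), ‖(if j % 2 = ε then
      ((lagWeight (2 * k - 1) j : ℝ) : ℂ) *
      (characterSum k (m + 1 - j) θ / (((2 * (k : ℝ) - 1) ^ (m + 1 - j) : ℝ) : ℂ)) else 0)‖ ≤
      (2 * k - 1) * (2 + 2 * k) * Real.exp (-(decayRate k * ∑ i, φ i ^ 2)) * (1 / 2) ^ j := by
    intro j hj
    have hj' : j ≤ m + 1 := by simpa [Nat.lt_succ_iff] using hj
    have hw := lagWeight_nonneg (by linarith : (1 : ℝ) < 2 * k - 1) j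
    have hq0 : (0 : ℝ) < 2 * k - 1 := by linarith
    split_ifs
    swap
    · rw [norm_zero]; positivity
    rw [norm_mul, Complex.norm_real, Real.norm_eq_abs, abs_of_nonneg hw]
    have h1 := norm_characterSum_div_pow_le hk hθ (m + 1 - j)
    -- Since `m X = |φ|²`, the full power gives a Gaussian bound independent of `m`, and the `j`
    -- missing factors cost `(3/2) ^ j`. Against `(1/3) ^ j` a geometric series of ratio `1/2`
    -- remains.
    have h2 : Real.exp (-(decayRate k * X)) ^ (m + 1 - j) ≤
        Real.exp (-(decayRate k * ∑ i, φ i ^ 2)) * (3 / 2) ^ j := by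
      calc Real.exp (-(decayRate k * X)) ^ (m + 1 - j)
          = Real.exp (-(decayRate k * ∑ i, φ i ^ 2)) * Real.exp (-(decayRate k * X)) *
              Real.exp (decayRate k * X) ^ j := by
            rw [← Real.exp_nat_mul, ← Real.exp_nat_mul, ← Real.exp_add, ← Real.exp_add, hXφ,
              Nat.cast_sub hj']
            congr 1
            push_cast
            ring
        _ ≤ Real.exp (-(decayRate k * ∑ i, φ i ^ 2)) * 1 * (3 / 2) ^ j := by
            gcongr
            rw [Real.exp_le_one_iff, neg_nonpos]
            positivity
        _ = _ := by rw [mul_one]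
    calc lagWeight (2 * k - 1) j * _
        ≤ ((2 * k - 1) * (1 / 3) ^ j) * ((2 + 2 * k) *
            (Real.exp (-(decayRate k * ∑ i, φ i ^ 2)) * (3 / 2) ^ j)) := by
          refine mul_le_mul (lagWeight_le hq j) (h1.trans ?_) (norm_nonneg _) (by positivity)
          gcongr
      _ = (2 * k - 1) * (2 + 2 * k) * Real.exp (-(decayRate k * ∑ i, φ i ^ 2)) *
            ((1 / 3) ^ j * (3 / 2) ^ j) := by ring
      _ = _ := by rw [← mul_pow]; norm_num
  refine (norm_sum_le _ _).trans ((Finset.sum_le_sum hterm).trans ?_)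
  rw [← Finset.mul_sum]
  have hgeom : ∑ j ∈ Finset.range (m + 2), (1 / 2 : ℝ) ^ j ≤ 2 := by
    have := Summable.sum_le_tsum (Finset.range (m + 2)) (fun j _ => by positivity)
      (summable_geometric_two)
    rwa [tsum_geometric_two] at this
  have hq0 : (0 : ℝ) < 2 * k - 1 := by linarith
  calc _ ≤ (2 * k - 1) * (2 + 2 * k) * Real.exp (-(decayRate k * ∑ i, φ i ^ 2)) * 2 := by gcongr
    _ = _ := by ring

theorem integrable_exp_neg_mul_sum_sq {b : ℝ} (hb : 0 < b) :
    Integrable fun φ : Fin k → ℝ => Real.exp (-(b * ∑ i, φ i ^ 2)) := by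
  have := Integrable.fintype_prod (μ := fun _ : Fin k => (volume : Measure ℝ))
    (f := fun _ x => Real.exp (-b * x ^ 2)) fun _ => integrable_exp_neg_mul_sq hb
  refine this.congr (ae_of_all _ fun φ => ?_)
  simp only [← Real.exp_sum, neg_mul, Finset.sum_neg_distrib, Finset.mul_sum]

/-- The limiting Gaussian characteristic function of each parity class. -/
noncomputable def halfGaussian (k : ℕ) (φ : Fin k → ℝ) : ℂ :=
  ((1 / 2 * Real.exp (-(∑ i, φ i ^ 2) / (2 * ((k : ℝ) - 1))) : ℝ) : ℂ)

theorem continuous_halfGaussian : Continuous (halfGaussian k) := by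
  unfold halfGaussian
  fun_prop

theorem integrable_halfGaussian (hk : 2 ≤ k) : Integrable (halfGaussian k) := by
  have hk' : (2 : ℝ) ≤ k := by exact_mod_cast hk
  have hb : 0 < 1 / (2 * ((k : ℝ) - 1)) := one_div_pos.2 (by linarith)
  have := ((integrable_exp_neg_mul_sum_sq (k := k) hb).const_mul (1 / 2)).ofReal (𝕜 := ℂ)
  refine this.congr (ae_of_all _ fun φ => ?_)
  simp only [halfGaussian]
  congr 3
  ring_nf

theorem integrable_scaledCharFun (hk : 2 ≤ k) {m : ℕ} (hm : m ≠ 0) (ε : ℕ) :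
    Integrable (scaledCharFun k m ε) :=
  ((integrable_exp_neg_mul_sum_sq (decayRate_pos hk)).const_mul _).mono'
    (measurable_scaledCharFun k m ε).aestronglyMeasurable
    (ae_of_all _ (norm_scaledCharFun_le hk hm ε))

/-- The `L¹` distance between the scaled characteristic function and its Gaussian limit. -/
noncomputable def charFunDiscrepancy (k m ε : ℕ) : ℝ :=
  ∫ φ, ‖scaledCharFun k m ε φ - halfGaussian k φ‖

theorem charFunDiscrepancy_nonneg (k m ε : ℕ) : 0 ≤ charFunDiscrepancy k m ε :=
  integral_nonneg fun _ => norm_nonneg _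

theorem tendsto_charFunDiscrepancy (hk : 2 ≤ k) {ε : ℕ} (hε : ε < 2) :
    Tendsto (fun m => charFunDiscrepancy k m ε) atTop (𝓝 0) := by
  have := tendsto_integral_filter_of_dominated_convergence (μ := volume) (l := atTop)
    (F := fun m φ => ‖scaledCharFun k m ε φ - halfGaussian k φ‖) (f := fun _ => (0 : ℝ))
    (fun φ => 2 * (2 * k - 1) * (2 + 2 * k) * Real.exp (-(decayRate k * ∑ i, φ i ^ 2)) +
      ‖halfGaussian k φ‖) ?_ ?_ ?_ ?_
  · simpa [charFunDiscrepancy] using this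
  · exact Eventually.of_forall fun m => ((measurable_scaledCharFun k m ε).sub
      continuous_halfGaussian.measurable).norm.aestronglyMeasurable
  · filter_upwards [eventually_ne_atTop 0] with m hm
    refine ae_of_all _ fun φ => ?_
    rw [norm_norm]
    exact (norm_sub_le _ _).trans (add_le_add_left (norm_scaledCharFun_le hk hm ε φ) _)
  · exact ((integrable_exp_neg_mul_sum_sq (decayRate_pos hk)).const_mul _).add
      (integrable_halfGaussian hk).norm
  · refine ae_of_all _ fun φ => ?_
    have h1 : Tendsto (fun m => scaledCharFun k m ε φ) atTop (𝓝 (halfGaussian k φ)) := by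
      refine (tendsto_parityCharFun hk hε φ).congr' ?_
      filter_upwards [eventually_inv_sqrt_smul_mem_halfTorus φ] with m hm
      rw [scaledCharFun, Set.indicator_of_mem hm]
    have h2 := (h1.sub_const (halfGaussian k φ)).norm
    simpa using h2

/-- The centred Gaussian density on `ℝ ^ k` of variance `v`, at the point `β / √m`. -/
noncomputable def scaledGaussian (v : ℝ) (m : ℕ) (β : Fin k → ℤ) : ℝ :=
  (2 * Real.pi * v) ^ (-((k : ℝ) / 2)) * Real.exp (-(∑ i, (β i : ℝ) ^ 2) / (2 * v * m))

theorem integral_halfGaussian_mul_latticeChar (hk : 2 ≤ k) {m : ℕ} (hm : m ≠ 0)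
    (β : Fin k → ℤ) :
    ∫ φ, halfGaussian k φ * latticeChar ((Real.sqrt m)⁻¹ • φ) (-β) =
      (((2 * Real.pi) ^ k / 2 * scaledGaussian (1 / ((k : ℝ) - 1)) m β : ℝ) : ℂ) := by
  have hk' : (2 : ℝ) ≤ k := by exact_mod_cast hk
  have hk1 : 0 < (k : ℝ) - 1 := by linarith
  have hm0 : (0 : ℝ) < m := by positivity
  have hpi := Real.pi_pos
  set b : ℝ := 1 / (2 * ((k : ℝ) - 1)) with hb
  have hb0 : 0 < b := by positivity
  have h1 : ∀ φ : Fin k → ℝ, halfGaussian k φ * latticeChar ((Real.sqrt m)⁻¹ • φ) (-β) =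
      (1 / 2 : ℂ) * Complex.exp (-∑ i, (b : ℂ) * (φ i : ℂ) ^ 2 +
        ∑ i, (-Complex.I * ((Real.sqrt m)⁻¹ : ℝ) * (β i : ℂ)) * (φ i : ℂ)) := by
    intro φ
    rw [Complex.exp_add, halfGaussian, latticeChar]
    push_cast
    rw [mul_assoc]
    congr 3
    · rw [← Finset.mul_sum, hb]
      push_cast
      ring
    · rw [Finset.mul_sum]
      refine Finset.sum_congr rfl fun i _ => ?_
      simp
      ring
  simp only [h1]
  rw [integral_const_mul, GaussianFourier.integral_cexp_neg_sum_mul_add (fun _ => by simpa using hb0),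
    Finset.prod_mul_distrib, ← Complex.exp_sum]
  have h2 : ((Real.pi : ℂ) / (b : ℂ)) ^ (1 / 2 : ℂ) = ((Real.sqrt (Real.pi / b) : ℝ) : ℂ) := by
    rw [Real.sqrt_eq_rpow, Complex.ofReal_cpow (by positivity)]
    push_cast
    rfl
  have h3 : ∑ i, (-Complex.I * (((Real.sqrt m)⁻¹ : ℝ) : ℂ) * (β i : ℂ)) ^ 2 / (4 * (b : ℂ)) =
      ((-(∑ i, (β i : ℝ) ^ 2) / (2 * (1 / ((k : ℝ) - 1)) * m) : ℝ) : ℂ) := by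
    have hs : ((((Real.sqrt m)⁻¹ : ℝ) : ℂ)) ^ 2 = ((m⁻¹ : ℝ) : ℂ) := by
      rw [← Complex.ofReal_pow, inv_pow, Real.sq_sqrt hm0.le]
    simp only [mul_pow, neg_sq, Complex.I_sq, hs]
    rw [← Finset.sum_div, ← Finset.mul_sum, hb]
    push_cast
    field_simp
    ring
  have h4 : Real.sqrt (Real.pi / b) ^ k =
      (2 * Real.pi) ^ k * (2 * Real.pi * (1 / ((k : ℝ) - 1))) ^ (-((k : ℝ) / 2)) := by
    have h5 : Real.pi / b = (2 * Real.pi) ^ 2 * (2 * Real.pi * (1 / ((k : ℝ) - 1)))⁻¹ := by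
      rw [hb]; field_simp
    have h6 : 0 < 2 * Real.pi * (1 / ((k : ℝ) - 1)) := by positivity
    rw [h5, Real.sqrt_mul (by positivity), Real.sqrt_sq (by positivity), mul_pow,
      Real.sqrt_eq_rpow, ← Real.rpow_natCast (_ ^ (1 / 2 : ℝ)), ← Real.rpow_mul (by positivity),
      Real.inv_rpow h6.le, Real.rpow_neg h6.le]
    congr 3
    ring
  rw [h2, h3, Finset.prod_const, Finset.card_univ, Fintype.card_fin, scaledGaussian,
    ← Complex.ofReal_pow, h4]
  push_cast
  ring

/-- The uniform local limit theorem for the averaged counts. -/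
theorem abs_averagedCount_sub_scaledGaussian_le (hk : 2 ≤ k) {m : ℕ} (hm : m ≠ 0)
    (β : Fin k → ℤ) :
    |Real.sqrt m ^ k * averagedCount m β - scaledGaussian (1 / ((k : ℝ) - 1)) m β| ≤
      2 / (2 * Real.pi) ^ k * (charFunDiscrepancy k m 0 + charFunDiscrepancy k m 1) := by
  have hm0 : (0 : ℝ) < m := by positivity
  have hpi := Real.pi_pos
  have hsq : 0 < Real.sqrt m := Real.sqrt_pos.2 hm0
  obtain ⟨ε, hε, hpar⟩ : ∃ ε : ℕ, ε < 2 ∧ ((m : ℤ) + 1 - ∑ i, β i) % 2 = ε :=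
    ⟨(((m : ℤ) + 1 - ∑ i, β i) % 2).toNat, by omega, by omega⟩
  have hscale : ∫ φ, scaledCharFun k m ε φ * latticeChar ((Real.sqrt m)⁻¹ • φ) (-β) =
      ((Real.sqrt m ^ k : ℝ) : ℂ) *
        ∫ θ in halfTorus k, parityCharFun k m ε θ * latticeChar θ (-β) := by
    have h1 : ∀ φ : Fin k → ℝ, scaledCharFun k m ε φ * latticeChar ((Real.sqrt m)⁻¹ • φ) (-β) =
        (halfTorus k).indicator (fun θ => parityCharFun k m ε θ * latticeChar θ (-β))
          ((Real.sqrt m)⁻¹ • φ) := by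
      intro φ
      rw [scaledCharFun]
      by_cases h : (Real.sqrt m)⁻¹ • φ ∈ halfTorus k
      · rw [Set.indicator_of_mem h, Set.indicator_of_mem h]
      · rw [Set.indicator_of_notMem h, Set.indicator_of_notMem h, zero_mul]
    simp only [h1]
    rw [Measure.integral_comp_smul, integral_indicator measurableSet_halfTorus,
      Module.finrank_fin_fun, inv_pow, inv_inv, abs_of_pos (by positivity), Complex.real_smul]
  have hdiff : ((Real.sqrt m ^ k * averagedCount m β -
      scaledGaussian (1 / ((k : ℝ) - 1)) m β : ℝ) : ℂ) = ((2 / (2 * Real.pi) ^ k : ℝ) : ℂ) *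
        ∫ φ, (scaledCharFun k m ε φ - halfGaussian k φ) *
          latticeChar ((Real.sqrt m)⁻¹ • φ) (-β) := by
    have hint : ∀ f : (Fin k → ℝ) → ℂ, Integrable f →
        Integrable fun φ => f φ * latticeChar ((Real.sqrt m)⁻¹ • φ) (-β) := by
      intro f hf
      refine hf.mul_bdd (c := 1) ?_ (ae_of_all _ fun φ => (norm_latticeChar _ _).le)
      exact ((continuous_latticeChar (-β)).comp
        (continuous_const_smul ((Real.sqrt m)⁻¹))).aestronglyMeasurable
    simp only [sub_mul]
    rw [integral_sub (hint _ (integrable_scaledCharFun hk hm ε))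
      (hint _ (integrable_halfGaussian hk)), hscale,
      integral_halfGaussian_mul_latticeChar hk hm, Complex.ofReal_sub, Complex.ofReal_mul,
      averagedCount_eq_integral hk hpar]
    have hne : ((2 * Real.pi : ℝ) : ℂ) ^ k ≠ 0 := by
      exact_mod_cast (by positivity : (2 * Real.pi) ^ k ≠ 0)
    push_cast at hne ⊢
    field_simp
  rw [← Real.norm_eq_abs, ← Complex.norm_real, hdiff, norm_mul, Complex.norm_real,
    Real.norm_eq_abs, abs_of_pos (by positivity)]
  refine mul_le_mul_of_nonneg_left ?_ (by positivity)
  calc _ ≤ ∫ φ, ‖(scaledCharFun k m ε φ - halfGaussian k φ) *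
          latticeChar ((Real.sqrt m)⁻¹ • φ) (-β)‖ := norm_integral_le_integral_norm _
    _ = charFunDiscrepancy k m ε := by
        simp only [norm_mul, norm_latticeChar, mul_one, charFunDiscrepancy]
    -- Adding the discrepancies of both parities makes the bound independent of `β`.
    _ ≤ _ := by
        have h0 := charFunDiscrepancy_nonneg k m 0
        have h1 := charFunDiscrepancy_nonneg k m 1
        interval_cases ε <;> linarith

theorem tendsto_uniform_error (hk : 2 ≤ k) : Tendsto (fun m => 2 / (2 * Real.pi) ^ k *
    (charFunDiscrepancy k m 0 + charFunDiscrepancy k m 1)) atTop (𝓝 0) := by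
  simpa using ((tendsto_charFunDiscrepancy hk (by norm_num : 0 < 2)).add
    (tendsto_charFunDiscrepancy hk (by norm_num : 1 < 2))).const_mul (2 / (2 * Real.pi) ^ k)

/-- The total mass of the averaged counts at `m`. -/
noncomputable def totalMass (k m : ℕ) : ℝ :=
  (parityCharFun k m 0 0 + parityCharFun k m 1 0).re

/-- At `φ = 0` rescaling does nothing, so the mass of each parity tends to `1/2`. -/
theorem tendsto_totalMass (hk : 2 ≤ k) : Tendsto (totalMass k) atTop (𝓝 1) := by
  have h0 := tendsto_parityCharFun hk (by norm_num : 0 < 2) 0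
  have h1 := tendsto_parityCharFun hk (by norm_num : 1 < 2) 0
  have := (Complex.continuous_re.tendsto _).comp (h0.add h1)
  rw [← Complex.ofReal_add, Complex.ofReal_re] at this
  convert this using 2
  · funext m
    simp [totalMass]
  · norm_num

theorem characterSum_apply_zero (n : ℕ) :
    characterSum k n 0 = (cyclicallyReducedOfNorm k n).card := by
  simp [characterSum, latticeChar]

theorem sum_averagedCount_le_totalMass (hk : 2 ≤ k) (m : ℕ) (A : Finset (Fin k → ℤ)) :
    ∑ β ∈ A, averagedCount m β ≤ totalMass k m := by
  classical
  have hq := three_le_two_mul_sub_one hk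
  have hq0 : (0 : ℝ) < 2 * k - 1 := by linarith
  have htot : totalMass k m = ∑ j ∈ Finset.range (m + 2), lagWeight (2 * k - 1) j *
      (((cyclicallyReducedOfNorm k (m + 1 - j)).card : ℝ) / (2 * (k : ℝ) - 1) ^ (m + 1 - j)) := by
    rw [totalMass, parityCharFun, parityCharFun, ← Finset.sum_add_distrib, Complex.re_sum]
    refine Finset.sum_congr rfl fun j _ => ?_
    rw [characterSum_apply_zero, ← Complex.ofReal_natCast, ← Complex.ofReal_div,
      ← Complex.ofReal_mul]
    rcases Nat.mod_two_eq_zero_or_one j with h | h <;>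
      simp only [h, if_true, zero_ne_one, one_ne_zero, if_false, add_zero, zero_add,
        Complex.ofReal_re]
  rw [htot]
  simp only [averagedCount_eq_sum hk]
  rw [Finset.sum_comm]
  refine Finset.sum_le_sum fun j _ => ?_
  rw [← Finset.mul_sum, ← Finset.sum_div]
  refine mul_le_mul_of_nonneg_left ?_ (lagWeight_nonneg (by linarith) j)
  gcongr
  have : ∑ β ∈ A, sphereCount (m + 1 - j) β ≤ (cyclicallyReducedOfNorm k (m + 1 - j)).card := by
    unfold sphereCount
    rw [Finset.sum_card_fiberwise_eq_card_filter]
    exact Finset.card_filter_le _ _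
  exact_mod_cast this

end LocalLimit

end FreeGroupLog

namespace FreeGroupLog

open Filter Topology

/-! ### Mass and tails of the discretized Gaussian -/

section LatticeGaussian

theorem summable_exp_neg_mul_int_sq {a : ℝ} (ha : 0 < a) :
    Summable fun n : ℤ => Real.exp (-a * (n : ℝ) ^ 2) := by
  have hnat : Summable fun n : ℕ => Real.exp (-a * (n : ℝ) ^ 2) := by
    refine Summable.of_nonneg_of_le (fun n => (Real.exp_pos _).le) (fun n => ?_)
      (summable_geometric_of_lt_one (Real.exp_pos (-a)).le (by simpa using ha))
    rw [← Real.exp_nat_mul]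
    refine Real.exp_le_exp.2 ?_
    have : (n : ℝ) ≤ (n : ℝ) ^ 2 := by exact_mod_cast Nat.le_self_pow two_ne_zero n
    nlinarith
  exact Summable.of_nat_of_neg (by simpa using hnat) (by simpa using hnat)

/-- The weights of the discretized one-dimensional Gaussian of variance `v * m`. -/
noncomputable def gaussianWeight (v : ℝ) (m : ℕ) (b : ℤ) : ℝ :=
  (Real.sqrt (2 * Real.pi * v * m))⁻¹ * Real.exp (-(1 / (2 * v * m)) * (b : ℝ) ^ 2)

variable {v : ℝ}

theorem gaussianWeight_nonneg (v : ℝ) (m : ℕ) (b : ℤ) : 0 ≤ gaussianWeight v m b :=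
  mul_nonneg (inv_nonneg.2 (Real.sqrt_nonneg _)) (Real.exp_pos _).le

theorem summable_gaussianWeight (hv : 0 < v) {m : ℕ} (hm : m ≠ 0) :
    Summable (gaussianWeight v m) := by
  have hm0 : (0 : ℝ) < m := by positivity
  exact (summable_exp_neg_mul_int_sq (by positivity)).mul_left _

/-- Poisson summation: on the dual side only the term `n = 0` survives as `m` grows, so the mass
tends to `1`. -/
theorem tsum_gaussianWeight (hv : 0 < v) {m : ℕ} (hm : m ≠ 0) :
    ∑' b, gaussianWeight v m b =
      ∑' n : ℤ, Real.exp (-(2 * Real.pi ^ 2 * v * m) * (n : ℝ) ^ 2) := by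
  have hm0 : (0 : ℝ) < m := by positivity
  have hpi := Real.pi_pos
  have hP : 0 < 2 * Real.pi * v * m := by positivity
  have h := Real.tsum_exp_neg_mul_int_sq (inv_pos.2 hP)
  have e1 : ∀ b : ℤ, -(1 / (2 * v * m)) * (b : ℝ) ^ 2 =
      -Real.pi * (2 * Real.pi * v * m)⁻¹ * (b : ℝ) ^ 2 := by
    intro b; field_simp
  have e2 : ∀ n : ℤ, -(2 * Real.pi ^ 2 * v * m) * (n : ℝ) ^ 2 =
      -Real.pi / (2 * Real.pi * v * m)⁻¹ * (n : ℝ) ^ 2 := by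
    intro b; field_simp
  simp only [gaussianWeight, e1, e2]
  rw [tsum_mul_left, h, ← Real.sqrt_eq_rpow, Real.sqrt_inv, one_div, inv_inv, ← mul_assoc,
    inv_mul_cancel₀ (Real.sqrt_pos.2 hP).ne', one_mul]

theorem tendsto_tsum_gaussianWeight (hv : 0 < v) :
    Tendsto (fun m : ℕ => ∑' b, gaussianWeight v m b) atTop (𝓝 1) := by
  have hpi := Real.pi_pos
  set a := 2 * Real.pi ^ 2 * v with ha
  have ha0 : 0 < a := by positivity
  have h1 : Tendsto (fun m : ℕ => ∑' n : ℤ, Real.exp (-(a * m) * (n : ℝ) ^ 2)) atTop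
      (𝓝 (∑' n : ℤ, if n = 0 then (1 : ℝ) else 0)) := by
    refine tendsto_tsum_of_dominated_convergence (summable_exp_neg_mul_int_sq ha0)
      (fun n => ?_) ?_
    · rcases eq_or_ne n 0 with rfl | hn
      · simp
      · rw [if_neg hn]
        refine Real.tendsto_exp_atBot.comp ?_
        have hn2 : 0 < a * (n : ℝ) ^ 2 := by positivity
        have := tendsto_neg_atTop_atBot.comp
          ((tendsto_natCast_atTop_atTop (R := ℝ)).const_mul_atTop hn2)
        refine this.congr fun m => ?_
        simp only [Function.comp]
        ring
    · filter_upwards [eventually_ge_atTop 1] with m hm n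
      rw [Real.norm_eq_abs, abs_of_pos (Real.exp_pos _)]
      refine Real.exp_le_exp.2 ?_
      have hm' : (1 : ℝ) ≤ m := by exact_mod_cast hm
      have : a * (n : ℝ) ^ 2 ≤ a * (n : ℝ) ^ 2 * m := le_mul_of_one_le_right (by positivity) hm'
      linarith
  rw [tsum_ite_eq] at h1
  refine h1.congr' ?_
  filter_upwards [eventually_ne_atTop 0] with m hm
  rw [tsum_gaussianWeight hv hm]

variable {k : ℕ}

theorem scaledGaussian_eq_prod (hv : 0 < v) {m : ℕ} (hm : m ≠ 0) (β : Fin k → ℤ) :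
    scaledGaussian v m β = Real.sqrt m ^ k * ∏ i, gaussianWeight v m (β i) := by
  have hm0 : (0 : ℝ) < m := by positivity
  have hpi := Real.pi_pos
  have hP : 0 < 2 * Real.pi * v := by positivity
  have hs := Real.sqrt_pos.2 hm0
  simp only [gaussianWeight]
  rw [Finset.prod_mul_distrib, ← Real.exp_sum, ← Finset.mul_sum, Finset.prod_const,
    Finset.card_univ, Fintype.card_fin, Real.sqrt_mul hP.le, mul_inv, mul_pow, scaledGaussian]
  have h1 : (2 * Real.pi * v) ^ (-((k : ℝ) / 2)) = (Real.sqrt (2 * Real.pi * v))⁻¹ ^ k := by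
    rw [Real.sqrt_eq_rpow, ← Real.rpow_neg hP.le, ← Real.rpow_natCast, ← Real.rpow_mul hP.le]
    congr 1
    ring
  have h2 : -(∑ i, (β i : ℝ) ^ 2) / (2 * v * m) = -(1 / (2 * v * m)) * ∑ i, (β i : ℝ) ^ 2 := by
    ring
  rw [h1, h2, inv_pow (Real.sqrt m)]
  field_simp

/-- The lattice points of sup norm at most `N`. -/
noncomputable def latticeBox (k : ℕ) (N : ℕ) : Finset (Fin k → ℤ) :=
  Fintype.piFinset fun _ => Finset.Icc (-(N : ℤ)) N

theorem mem_latticeBox {N : ℕ} {β : Fin k → ℤ} : β ∈ latticeBox k N ↔ ∀ i, |β i| ≤ N := by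
  simp [latticeBox, abs_le]

theorem card_latticeBox (N : ℕ) : (latticeBox k N).card = (2 * N + 1) ^ k := by
  rw [latticeBox, Fintype.card_piFinset_const, Int.card_Icc]
  congr 1
  omega

theorem sum_latticeBox_prod_gaussianWeight (m N : ℕ) :
    ∑ β ∈ latticeBox k N, ∏ i, gaussianWeight v m (β i) =
      (∑ b ∈ Finset.Icc (-(N : ℤ)) N, gaussianWeight v m b) ^ k := by
  rw [latticeBox, ← Finset.prod_univ_sum, Finset.prod_const, Finset.card_univ, Fintype.card_fin]

theorem tendsto_sum_latticeBox (hv : 0 < v) {m : ℕ} (hm : m ≠ 0) :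
    Tendsto (fun N => ∑ β ∈ latticeBox k N, ∏ i, gaussianWeight v m (β i)) atTop
      (𝓝 ((∑' b, gaussianWeight v m b) ^ k)) := by
  simp only [sum_latticeBox_prod_gaussianWeight]
  exact ((summable_gaussianWeight hv hm).hasSum.comp Finset.tendsto_Icc_neg).pow k

theorem exists_subset_latticeBox (A : Finset (Fin k → ℤ)) : ∃ N, A ⊆ latticeBox k N := by
  refine ⟨A.sup fun β => ∑ i, (β i).natAbs, fun β hβ => mem_latticeBox.2 fun i => ?_⟩
  have h1 : (β i).natAbs ≤ ∑ i, (β i).natAbs :=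
    Finset.single_le_sum (f := fun i => (β i).natAbs) (fun _ _ => Nat.zero_le _)
      (Finset.mem_univ i)
  have h2 := h1.trans (Finset.le_sup (f := fun β : Fin k → ℤ => ∑ i, (β i).natAbs) hβ)
  rw [Int.abs_eq_natAbs]
  exact_mod_cast h2

theorem sum_prod_gaussianWeight_le (hv : 0 < v) {m : ℕ} (hm : m ≠ 0) (A : Finset (Fin k → ℤ)) :
    ∑ β ∈ A, ∏ i, gaussianWeight v m (β i) ≤ (∑' b, gaussianWeight v m b) ^ k := by
  have hnn : ∀ β : Fin k → ℤ, 0 ≤ ∏ i, gaussianWeight v m (β i) := fun β =>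
    Finset.prod_nonneg fun i _ => gaussianWeight_nonneg _ _ _
  obtain ⟨N, hN⟩ := exists_subset_latticeBox A
  calc _ ≤ ∑ β ∈ latticeBox k N, ∏ i, gaussianWeight v m (β i) :=
        Finset.sum_le_sum_of_subset_of_nonneg hN fun β _ _ => hnn β
    _ ≤ _ := by
        rw [sum_latticeBox_prod_gaussianWeight]
        refine pow_le_pow_left₀ (Finset.sum_nonneg fun b _ => gaussianWeight_nonneg _ _ _) ?_ k
        exact (summable_gaussianWeight hv hm).sum_le_tsum _ fun b _ => gaussianWeight_nonneg _ _ _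

/-- Half of the exponent supplies the small factor; the other half is a Gaussian of variance `2 v`,
whose mass is bounded, and `√2 ^ k` corrects the normalization. -/
theorem prod_gaussianWeight_le_of_le_sum_sq (hv : 0 < v) {m : ℕ} (hm : m ≠ 0) {R : ℝ}
    {β : Fin k → ℤ} (hβ : R ^ 2 * m ≤ ∑ i, (β i : ℝ) ^ 2) :
    ∏ i, gaussianWeight v m (β i) ≤
      Real.exp (-(R ^ 2 / (4 * v))) * Real.sqrt 2 ^ k * ∏ i, gaussianWeight (2 * v) m (β i) := by
  have hm0 : (0 : ℝ) < m := by positivity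
  have hpi := Real.pi_pos
  have hP : 0 < 2 * Real.pi * v * m := by positivity
  simp only [gaussianWeight]
  rw [Finset.prod_mul_distrib, Finset.prod_mul_distrib, ← Real.exp_sum, ← Real.exp_sum,
    ← Finset.mul_sum, ← Finset.mul_sum, Finset.prod_const, Finset.prod_const, Finset.card_univ,
    Fintype.card_fin, show 2 * Real.pi * (2 * v) * m = 2 * (2 * Real.pi * v * m) by ring,
    Real.sqrt_mul (by norm_num : (0 : ℝ) ≤ 2)]
  set X := ∑ i, (β i : ℝ) ^ 2
  have h1 : Real.exp (-(1 / (2 * v * m)) * X) ≤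
      Real.exp (-(R ^ 2 / (4 * v))) * Real.exp (-(1 / (2 * (2 * v) * m)) * X) := by
    rw [← Real.exp_add]
    refine Real.exp_le_exp.2 ?_
    have h2 : R ^ 2 / (4 * v) ≤ X / (4 * v * m) := by
      rw [div_le_div_iff₀ (by positivity) (by positivity)]
      nlinarith
    have h3 : 1 / (2 * v * m) * X = 2 * (X / (4 * v * m)) := by field_simp; ring
    have h4 : 1 / (2 * (2 * v) * m) * X = X / (4 * v * m) := by field_simp; ring
    rw [neg_mul, neg_mul, h3, h4]
    linarith
  have hs2 : Real.sqrt 2 ≠ 0 := by positivity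
  calc _ ≤ (Real.sqrt (2 * Real.pi * v * m))⁻¹ ^ k *
        (Real.exp (-(R ^ 2 / (4 * v))) * Real.exp (-(1 / (2 * (2 * v) * m)) * X)) := by gcongr
    _ = _ := by
        rw [mul_inv, mul_pow, inv_pow (Real.sqrt 2)]
        field_simp

end LatticeGaussian

/-! ### Scheffé's argument -/

section TotalVariation

variable {k : ℕ}

/-- Only the deficit of the counts is bounded, so far from the origin nonnegativity of the counts
suffices and no tail estimate for them is needed. In a box of side of order `R √m`, the uniform
error times the number of points tends to zero. -/
theorem eventually_sum_gaussian_sub_averagedCount_le (hk : 2 ≤ k) {ε : ℝ} (hε : 0 < ε) :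
    ∀ᶠ m : ℕ in atTop, ∀ A : Finset (Fin k → ℤ),
      ∑ β ∈ A, ((∏ i, gaussianWeight (1 / ((k : ℝ) - 1)) m (β i)) - averagedCount m β) ≤ ε := by
  classical
  have hk' : (2 : ℝ) ≤ k := by exact_mod_cast hk
  have hv : 0 < 1 / ((k : ℝ) - 1) := one_div_pos.2 (by linarith)
  set v := 1 / ((k : ℝ) - 1) with hvdef
  -- The final factor `2` bounds the eventual mass of the variance `2 v` Gaussian.
  obtain ⟨R, hR1, hR⟩ : ∃ R : ℝ, 0 ≤ R ∧
      Real.exp (-(R ^ 2 / (4 * v))) * Real.sqrt 2 ^ k * 2 ≤ ε / 2 := by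
    have h1 : Tendsto (fun R : ℝ => Real.exp (-(R ^ 2 / (4 * v))) * Real.sqrt 2 ^ k * 2) atTop
        (𝓝 (0 * Real.sqrt 2 ^ k * 2)) := by
      refine Tendsto.mul_const _ (Tendsto.mul_const _ ?_)
      exact Real.tendsto_exp_neg_atTop_nhds_zero.comp
        ((tendsto_pow_atTop two_ne_zero).atTop_div_const (by positivity))
    rw [zero_mul, zero_mul] at h1
    obtain ⟨R, h2, h3⟩ := ((h1.eventually (gt_mem_nhds (half_pos hε))).and
      (eventually_ge_atTop 0)).exists
    exact ⟨R, h3, h2.le⟩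
  set η : ℕ → ℝ := fun m => 2 / (2 * Real.pi) ^ k *
    (charFunDiscrepancy k m 0 + charFunDiscrepancy k m 1) with hη
  have hηlim : Tendsto (fun m => (2 * R + 3) ^ k * η m) atTop (𝓝 0) := by
    simpa using (tendsto_uniform_error hk).const_mul ((2 * R + 3) ^ k)
  have hT : Tendsto (fun m : ℕ => (∑' b, gaussianWeight (2 * v) m b) ^ k) atTop (𝓝 1) := by
    simpa using (tendsto_tsum_gaussianWeight (by positivity : 0 < 2 * v)).pow k
  filter_upwards [eventually_ne_atTop 0, hηlim.eventually (gt_mem_nhds (half_pos hε)),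
    hT.eventually (gt_mem_nhds one_lt_two)] with m hm hηm hTm A
  have hm1 : (1 : ℝ) ≤ m := by exact_mod_cast Nat.one_le_iff_ne_zero.2 hm
  have hs1 : 1 ≤ Real.sqrt m := Real.one_le_sqrt.2 hm1
  have hη0 : 0 ≤ η m := mul_nonneg (by positivity)
    (add_nonneg (charFunDiscrepancy_nonneg _ _ _) (charFunDiscrepancy_nonneg _ _ _))
  set M := ⌈R * Real.sqrt m⌉₊ with hM
  rw [← Finset.sum_filter_add_sum_filter_not A (· ∈ latticeBox k M)]
  have hin : ∑ β ∈ A.filter (· ∈ latticeBox k M),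
      ((∏ i, gaussianWeight v m (β i)) - averagedCount m β) ≤ (2 * R + 3) ^ k * η m := by
    have hterm : ∀ β ∈ A.filter (· ∈ latticeBox k M),
        (∏ i, gaussianWeight v m (β i)) - averagedCount m β ≤ η m / Real.sqrt m ^ k := by
      intro β _
      have h1 := abs_averagedCount_sub_scaledGaussian_le hk hm β
      rw [scaledGaussian_eq_prod hv hm, ← mul_sub] at h1
      rw [le_div_iff₀ (by positivity)]
      have h2 := neg_le_of_abs_le h1
      linarith
    refine (Finset.sum_le_sum hterm).trans ?_
    rw [Finset.sum_const, nsmul_eq_mul]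
    have hcard : ((A.filter (· ∈ latticeBox k M)).card : ℝ) ≤
        (2 * R + 3) ^ k * Real.sqrt m ^ k := by
      have h1 : (A.filter (· ∈ latticeBox k M)).card ≤ (2 * M + 1) ^ k := by
        rw [← card_latticeBox]
        exact Finset.card_le_card fun β hβ => (Finset.mem_filter.1 hβ).2
      have h2 : (M : ℝ) ≤ R * Real.sqrt m + 1 := (Nat.ceil_lt_add_one (by positivity)).le
      calc _ ≤ (2 * (M : ℝ) + 1) ^ k := by exact_mod_cast h1
        -- `2 M + 1 ≤ 2 R √m + 3`, and `√m ≥ 1`.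
        _ ≤ ((2 * R + 3) * Real.sqrt m) ^ k := by
            refine pow_le_pow_left₀ (by positivity) ?_ k
            nlinarith
        _ = _ := mul_pow _ _ _
    calc _ ≤ (2 * R + 3) ^ k * Real.sqrt m ^ k * (η m / Real.sqrt m ^ k) := by gcongr
      _ = _ := by field_simp
  have hout : ∑ β ∈ A.filter (· ∉ latticeBox k M),
      ((∏ i, gaussianWeight v m (β i)) - averagedCount m β) ≤
        Real.exp (-(R ^ 2 / (4 * v))) * Real.sqrt 2 ^ k * 2 := by
    have hterm : ∀ β ∈ A.filter (· ∉ latticeBox k M),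
        (∏ i, gaussianWeight v m (β i)) - averagedCount m β ≤
          Real.exp (-(R ^ 2 / (4 * v))) * Real.sqrt 2 ^ k *
            ∏ i, gaussianWeight (2 * v) m (β i) := by
      intro β hβ
      have h1 := (Finset.mem_filter.1 hβ).2
      rw [mem_latticeBox] at h1
      push Not at h1
      obtain ⟨i, hi⟩ := h1
      have h2 : R * Real.sqrt m ≤ |(β i : ℝ)| := by
        have h3 : (M : ℝ) ≤ |(β i : ℝ)| := by exact_mod_cast hi.le
        exact (Nat.le_ceil _).trans h3
      have h3 : R ^ 2 * m ≤ ∑ i, (β i : ℝ) ^ 2 := by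
        calc R ^ 2 * m = (R * Real.sqrt m) ^ 2 := by
              rw [mul_pow, Real.sq_sqrt (by linarith)]
          _ ≤ |(β i : ℝ)| ^ 2 := pow_le_pow_left₀ (by positivity) h2 2
          _ = (β i : ℝ) ^ 2 := sq_abs _
          _ ≤ _ := Finset.single_le_sum (f := fun i => (β i : ℝ) ^ 2)
              (fun i _ => sq_nonneg _) (Finset.mem_univ i)
      have h4 := prod_gaussianWeight_le_of_le_sum_sq hv hm h3
      have h5 := averagedCount_nonneg hk m β
      linarith
    refine (Finset.sum_le_sum hterm).trans ?_
    rw [← Finset.mul_sum]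
    refine mul_le_mul_of_nonneg_left ?_ (by positivity)
    exact (sum_prod_gaussianWeight_le (by positivity) hm _).trans hTm.le
  linarith

/-- The averaged counts converge to the discretized Gaussian in total variation. -/
theorem eventually_abs_sum_averagedCount_sub_gaussian_le (hk : 2 ≤ k) {ε : ℝ} (hε : 0 < ε) :
    ∀ᶠ m : ℕ in atTop, ∀ W : Finset (Fin k → ℤ),
      |∑ β ∈ W, (averagedCount m β - ∏ i, gaussianWeight (1 / ((k : ℝ) - 1)) m (β i))| ≤ ε := by
  classical
  have hk' : (2 : ℝ) ≤ k := by exact_mod_cast hk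
  have hv : 0 < 1 / ((k : ℝ) - 1) := one_div_pos.2 (by linarith)
  set v := 1 / ((k : ℝ) - 1) with hvdef
  have hT : Tendsto (fun m : ℕ => (∑' b, gaussianWeight v m b) ^ k) atTop (𝓝 1) := by
    simpa using (tendsto_tsum_gaussianWeight hv).pow k
  have hε4 : 0 < ε / 4 := by linarith
  filter_upwards [eventually_ne_atTop 0, eventually_sum_gaussian_sub_averagedCount_le hk hε4,
    hT.eventually (lt_mem_nhds (by linarith : 1 - ε / 4 < 1)),
    (tendsto_totalMass hk).eventually (gt_mem_nhds (by linarith : 1 < 1 + ε / 4))]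
    with m hm hdef hTm htot W
  have hneg : ∀ A : Finset (Fin k → ℤ),
      -(ε / 4) ≤ ∑ β ∈ A, (averagedCount m β - ∏ i, gaussianWeight v m (β i)) := by
    intro A
    have h1 := hdef A
    rw [Finset.sum_sub_distrib] at h1 ⊢
    linarith
  rw [abs_le]
  refine ⟨by linarith [hneg W], ?_⟩
  -- An excess on `W` must be offset elsewhere. On `W` joined with a box carrying nearly all
  -- Gaussian mass the excess is at most `ε / 2`; the complement of `W` there contributes at least
  -- `-ε / 4`.
  obtain ⟨N, hN⟩ := ((tendsto_sum_latticeBox (k := k) hv hm).eventually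
    (lt_mem_nhds hTm)).exists
  have h1 : ∑ β ∈ latticeBox k N, ∏ i, gaussianWeight v m (β i) ≤
      ∑ β ∈ W ∪ latticeBox k N, ∏ i, gaussianWeight v m (β i) :=
    Finset.sum_le_sum_of_subset_of_nonneg Finset.subset_union_right fun β _ _ =>
      Finset.prod_nonneg fun i _ => gaussianWeight_nonneg _ _ _
  have h2 := sum_averagedCount_le_totalMass hk m (W ∪ latticeBox k N)
  have h3 := Finset.sum_sdiff (f := fun β => averagedCount m β - ∏ i, gaussianWeight v m (β i))
    (Finset.subset_union_left : W ⊆ W ∪ latticeBox k N)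
  have h4 := hneg ((W ∪ latticeBox k N) \ W)
  rw [Finset.sum_sub_distrib (s := W ∪ latticeBox k N)] at h3
  linarith

end TotalVariation

end FreeGroupLog

theorem theorem3p9 (k : ℕ) (hk : 2 ≤ k) (q σ : ℝ) (hq : q = 2 * (k : ℝ) - 1) (hσ : 0 < σ)
    (hσ2 : σ ^ 2 = 1 / ((k : ℝ) - 1)) (B : Set (Fin k → ℤ)) :
    (fun m : ℕ => ∑ β ∈ (FreeGroupLog.window_finite B m).toFinset,
        ((m : ℝ) ^ ((k : ℝ) / 2) *
            ((1 / 2) *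
              ((FreeGroupLog.cyclicallyReducedCount β m : ℝ) / (q ^ (m + 1) / (q - 1)) +
                (FreeGroupLog.cyclicallyReducedCount β (m + 1) : ℝ) / (q ^ (m + 2) / (q - 1))))
          - (2 * Real.pi * σ ^ 2) ^ (-((k : ℝ) / 2)) *
              Real.exp (-(∑ i, (β i : ℝ) ^ 2) / (2 * σ ^ 2 * (m : ℝ)))))
      =o[Filter.atTop] fun m : ℕ => (m : ℝ) ^ ((k : ℝ) / 2) := by
  have hv : 0 < 1 / ((k : ℝ) - 1) := by rw [← hσ2]; positivity
  rw [Asymptotics.isLittleO_iff]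
  intro ε hε
  filter_upwards [Filter.eventually_ne_atTop 0,
    FreeGroupLog.eventually_abs_sum_averagedCount_sub_gaussian_le hk hε] with m hm htv
  have hm0 : (0 : ℝ) < m := by positivity
  have hpow : (m : ℝ) ^ ((k : ℝ) / 2) = Real.sqrt m ^ k := by
    rw [Real.sqrt_eq_rpow, ← Real.rpow_natCast, ← Real.rpow_mul hm0.le]
    congr 1
    ring
  have hterm : ∀ β : Fin k → ℤ, (m : ℝ) ^ ((k : ℝ) / 2) *
            ((1 / 2) *
              ((FreeGroupLog.cyclicallyReducedCount β m : ℝ) / (q ^ (m + 1) / (q - 1)) +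
                (FreeGroupLog.cyclicallyReducedCount β (m + 1) : ℝ) / (q ^ (m + 2) / (q - 1))))
          - (2 * Real.pi * σ ^ 2) ^ (-((k : ℝ) / 2)) *
              Real.exp (-(∑ i, (β i : ℝ) ^ 2) / (2 * σ ^ 2 * (m : ℝ))) =
      Real.sqrt m ^ k * (FreeGroupLog.averagedCount m β -
        ∏ i, FreeGroupLog.gaussianWeight (1 / ((k : ℝ) - 1)) m (β i)) := by
    intro β
    rw [mul_sub, ← FreeGroupLog.scaledGaussian_eq_prod hv hm, FreeGroupLog.scaledGaussian,
      FreeGroupLog.averagedCount, hpow, hσ2, hq]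
  simp only [hterm]
  rw [← Finset.mul_sum, hpow, norm_mul, mul_comm ε]
  -- The total variation bound is uniform over finite sets, so neither `B` nor the shape of the
  -- window matters.
  exact mul_le_mul_of_nonneg_left (htv _) (norm_nonneg _)
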